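/- **Hypermaps.** A *hypermap* is a finite set $D$ of *darts* with three maps $e,n,f:D\to D$ (edge, node and face map) such that $e\circ n\circ f=\mathrm{id}_D$; these are then permutations, and their orbits are called the *edges*, *nodes* and *faces*. Two orbits *meet* if they have a dart in common. An *isomorphism* $(D,e,n,f)\to(D',e',n',f')$ is a bijection $\varphi:D\to D'$ with $\varphi e=e'\varphi$, $\varphi n=n'\varphi$, $\varphi f=f'\varphi$. The *opposite* of $(D,e,n,f)$ is $(D,\,f n,\,n^{-1},\,f^{-1})$. A hypermap is *connected* if $D\neq\varnothing$ and the group generated by $e,n,f$ is transitive on $D$, and *biconnected* if moreover it has no articulation node, i.e. deleting any one node leaves the remaining nodes connected (two nodes being adjacent if some edge meets both). **Weights.** Let $\mathrm{tgt}=1.541$. Let $b(0,3)=b(1,3)=0.618$, $b(2,2)=0.412$, and $b(p,q)=\mathrm{tgt}$ for all other $(p,q)\in\mathbb N^2$. Let $d_1(k)=0$ for $k\le 3$, $d_1(k)=0.206+0.27(k-4)$ for $4\le k\le 8$, and $d_1(k)=\mathrm{tgt}$ for $k>8$. A node has *type* $(p,q,r)$ if exactly $p+q+r$ faces meet it, of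 which exactly $p$ have cardinality $3$ and exactly $q$ have cardinality $4$. A *contact weight assignment* is a function $\tau$ from the set of faces to $[0,\infty)$ such that $\tau(F)\ge d_1(\operatorname{card}F)$ for every face $F$, and $\sum_{F:\,v\cap F\ne\varnothing}\tau(F)\ge b(p,q)$ for every node $v$ of type $(p,q,0)$. **Tame contact.** A hypermap has *tame contact* if: it is biconnected; it is plain ($e^2=\mathrm{id}$) and planar (connected, and the numbers of nodes, edges and faces add up to $\operatorname{card}(D)+2$); $e$ has no fixed points; the two darts of each edge lie in different nodes; at most one edge meets any two given (distinct) nodes; there are at least two faces; every face has between $3$ and $8$ darts; there are exactly twelve nodes; every node has between $2$ and $4$ darts; and there is a contact weight assignment $\tau$ with $\sum_F\tau(F)<\mathrm{tgt}$. **The list.** Each of the following eight lists of cyclic sequences of elements of $\{0,\dots,11\}$ describes a hypermap as follows. The darts are the pairs $(v,w)$ such that $w$ follows $v$ cyclically in one of the sequences; $e(v,w)=(w,v)$; $f(v,w)=(w,u)$, where $u$ follows $w$ in the sequence in which $w$ follows $v$; and $n=e^{-1}f^{-1}$. 1. (the FCC contact hypermap): $(0\,1\,2\,3); (5\,1\,4\,6);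 (7\,2\,5\,8); (4\,0\,9\,10); (8\,6\,10\,11); (3\,7\,11\,9); (1\,0\,4); (2\,1\,5); (3\,2\,7); (8\,5\,6); (0\,3\,9); (6\,4\,10); (7\,8\,11); (10\,9\,11)$ 2. (the HCP contact hypermap): $(0\,1\,2\,3); (5\,1\,4\,6); (7\,2\,5\,8); (0\,3\,9\,10); (6\,4\,10\,11); (7\,8\,11\,9); (1\,0\,4); (2\,1\,5); (3\,2\,7); (8\,5\,6); (4\,0\,10); (8\,6\,11); (3\,7\,9); (10\,9\,11)$ 3. $(0\,1\,2\,3); (5\,1\,4\,6); (7\,2\,5\,8); (8\,5\,6\,9); (0\,3\,10\,11); (6\,4\,11\,9); (8\,9\,10\,7); (1\,0\,4); (2\,1\,5); (3\,2\,7); (4\,0\,11); (10\,3\,7); (9\,11\,10)$ 4. $(0\,1\,2\,3\,4); (7\,2\,6\,8); (8\,6\,5\,9); (9\,5\,0\,10); (4\,3\,11\,10); (8\,9\,11\,7); (1\,0\,5); (2\,1\,6); (6\,1\,5); (3\,2\,7); (10\,0\,4); (9\,10\,11); (3\,7\,11)$ 5. $(0\,1\,2\,3\,4); (6\,1\,5\,7);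 (8\,2\,6\,9); (4\,3\,8\,10); (10\,9\,7\,11); (0\,4\,11\,5); (1\,0\,5); (2\,1\,6); (3\,2\,8); (9\,6\,7); (10\,8\,9); (4\,10\,11); (7\,5\,11)$ 6. $(0\,1\,2\,3\,4); (6\,1\,5\,7); (3\,2\,6\,8); (9\,3\,8\,10); (10\,7\,5\,11); (4\,9\,11\,0); (1\,0\,5); (2\,1\,6); (8\,6\,7); (4\,3\,9); (10\,8\,7); (9\,10\,11); (5\,0\,11)$ 7. $(0\,1\,2\,3\,4); (2\,1\,5\,6); (3\,2\,7\,8); (0\,4\,9\,10); (6\,5\,10\,11); (8\,7\,11\,9); (1\,0\,5); (7\,2\,6); (4\,3\,8); (5\,0\,10); (7\,6\,11); (4\,8\,9); (10\,9\,11)$ 8. (the hexagonal antiprism): $(0\,1\,2\,3\,4\,5); (8\,7\,6\,9\,10\,11); (1\,0\,6); (2\,1\,7); (7\,1\,6); (3\,2\,8); (8\,2\,7); (3\,8\,11); (4\,3\,11); (9\,6\,0); (4\,11\,10); (5\,4\,10); (9\,0\,5); (10\,9\,5)$ **Theorem (classification of hypermaps with tame contact).** Every hypermap with tame contact is isomorphic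 to one of these eight hypermaps, or to the opposite of one of them. -/

import Mathlib

/-- The set of orbits of a permutation `g`. -/
abbrev PermOrbit {D : Type*} (g : Equiv.Perm D) : Type _ :=
  Quotient (Equiv.Perm.SameCycle.setoid g)

/-- The orbit of `x` under the permutation `g`. -/
abbrev PermOrbit.of {D : Type*} (g : Equiv.Perm D) (x : D) : PermOrbit g :=
  Quotient.mk (Equiv.Perm.SameCycle.setoid g) x

/-- An orbit, as a set. -/
def PermOrbit.darts {D : Type*} {g : Equiv.Perm D} (O : PermOrbit g) : Set D :=
  {x | PermOrbit.of g x = O}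

/-- Two orbits (of possibly different permutations) meet if they have a common element. -/
def PermOrbit.Meets {D : Type*} {g h : Equiv.Perm D} (O : PermOrbit g) (P : PermOrbit h) : Prop :=
  (O.darts ∩ P.darts).Nonempty

/-- A hypermap structure on the set of darts `D` (which is assumed finite wherever it is used):
an edge map `e`, a node map `n` and a face map `f` with `e ∘ n ∘ f = id`. On a finite set, maps
that compose to the identity are permutations. -/
structure Hypermap (D : Type*) where
  e : Equiv.Perm D
  n : Equiv.Perm D
  f : Equiv.Perm D
  enf : e * n * f = 1

namespace Hypermap

/-- Isomorphism of hypermaps: a bijection of the darts that respects `e`, `n` and `f`. -/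
def IsIsomorphic {D D' : Type*} (H : Hypermap D) (H' : Hypermap D') : Prop :=
  ∃ φ : D ≃ D', (∀ x, φ (H.e x) = H'.e (φ x)) ∧ (∀ x, φ (H.n x) = H'.n (φ x)) ∧
    (∀ x, φ (H.f x) = H'.f (φ x))

variable {D : Type*} (H : Hypermap D)

/-- The opposite hypermap `(D, f n, n⁻¹, f⁻¹)`, the mirror image of `H`. -/
def opposite : Hypermap D where
  e := H.f * H.n
  n := H.n⁻¹
  f := H.f⁻¹
  enf := by group

/-- The edges, nodes and faces of a hypermap. -/
abbrev Edge : Type _ := PermOrbit H.e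
abbrev Node : Type _ := PermOrbit H.n
abbrev Face : Type _ := PermOrbit H.f

/-- `H` is connected: it has one combinatorial component, that is, the group generated
by `e`, `n`, `f` has exactly one orbit on the darts. -/
def IsConnected : Prop :=
  Nonempty D ∧ ∀ x y : D, ∃ g ∈ Subgroup.closure {H.e, H.n, H.f}, g x = y

/-- The graph on the nodes of `H`: two distinct nodes are adjacent if some edge meets both. -/
def nodeGraph : SimpleGraph H.Node where
  Adj v w := v ≠ w ∧ ∃ E : H.Edge, E.Meets v ∧ E.Meets w
  symm := ⟨fun _ _ h => ⟨h.1.symm, h.2.imp fun _ hE => ⟨hE.2, hE.1⟩⟩⟩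
  loopless := ⟨fun _ h => h.1 rfl⟩

/-- `H` is biconnected: it is connected, and no node is an articulation node, that is, deleting
any one node leaves the remaining nodes connected. -/
def IsBiconnected : Prop :=
  H.IsConnected ∧ ∀ v : H.Node, (H.nodeGraph.induce {w | w ≠ v}).Preconnected

/-- `H` is plain: the edge map is an involution. -/
def IsPlain : Prop := ∀ x, H.e (H.e x) = x

/-- `H` is planar: it is connected and Euler's relation holds. -/
def IsPlanar : Prop :=
  H.IsConnected ∧ Nat.card H.Node + Nat.card H.Edge + Nat.card H.Face = Nat.card D + 2

end Hypermap

/-- The target constant `tgt`. -/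
noncomputable def tgt : ℝ := 1.541

/-- The contact weight parameter `b (p, q)`. -/
noncomputable def contactB (p q : ℕ) : ℝ :=
  if (p, q) = (0, 3) ∨ (p, q) = (1, 3) then 0.618
  else if (p, q) = (2, 2) then 0.412
  else tgt

/-- The parameter `d₁ (k)`. -/
noncomputable def contactD (k : ℕ) : ℝ :=
  if k ≤ 3 then 0
  else if k ≤ 8 then 0.206 + 0.27 * ((k : ℝ) - 4)
  else tgt

namespace Hypermap

variable {D : Type*} (H : Hypermap D)

/-- The node `v` has type `(p, q, r)`: at `v` there are `p + q + r` faces, of which `p` are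
triangles and `q` are quadrilaterals. -/
def HasType (v : H.Node) (p q r : ℕ) : Prop :=
  {F : H.Face | F.Meets v}.ncard = p + q + r ∧
  {F : H.Face | F.Meets v ∧ F.darts.ncard = 3}.ncard = p ∧
  {F : H.Face | F.Meets v ∧ F.darts.ncard = 4}.ncard = q

/-- A contact weight assignment. -/
structure IsContactWeight (τ : H.Face → ℝ) : Prop where
  nonneg : ∀ F, 0 ≤ τ F
  face_bound : ∀ F : H.Face, contactD F.darts.ncard ≤ τ F
  node_bound : ∀ (v : H.Node) (p q : ℕ), H.HasType v p q 0 →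
    contactB p q ≤ ∑ᶠ F ∈ {F : H.Face | F.Meets v}, τ F

/-- Hypermaps with tame contact. -/
structure HasTameContact : Prop where
  biconnected : H.IsBiconnected
  plain : H.IsPlain
  planar : H.IsPlanar
  nondegenerate : ∀ x, H.e x ≠ x
  /-- the darts of an edge lie in different nodes -/
  no_loops : ∀ x y, H.e.SameCycle x y → x ≠ y → PermOrbit.of H.n x ≠ PermOrbit.of H.n y
  /-- at most one edge meets any two given nodes -/
  no_double_join : ∀ v w : H.Node, v ≠ w → ∀ E E' : H.Edge,
    E.Meets v → E.Meets w → E'.Meets v → E'.Meets w → E = E'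
  face_count : 2 ≤ Nat.card H.Face
  face_size : ∀ F : H.Face, 3 ≤ F.darts.ncard ∧ F.darts.ncard ≤ 8
  node_count : Nat.card H.Node = 12
  node_size : ∀ v : H.Node, 2 ≤ v.darts.ncard ∧ v.darts.ncard ≤ 4
  weights : ∃ τ : H.Face → ℝ, H.IsContactWeight τ ∧ ∑ᶠ F, τ F < tgt

end Hypermap

/-- The darts `(v₁, v₂), (v₂, v₃), …, (vₖ, v₁)` of the face with successive nodes `v₁, …, vₖ`. -/
def faceDarts (F : List (Fin 12)) : List (Fin 12 × Fin 12) := F.zip (F.rotate 1)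

/-- The permutation of ordered pairs that moves each dart of each face in the list to the
next dart of that face and fixes all other pairs. -/
def facePerm (L : List (List (Fin 12))) : Equiv.Perm (Fin 12 × Fin 12) :=
  (L.map fun F => (faceDarts F).formPerm).prod

/-- The map that reverses ordered pairs. -/
def swapPerm : Equiv.Perm (Fin 12 × Fin 12) := Equiv.prodComm (Fin 12) (Fin 12)

/-- Eight plane graphs on the nodes `0, …, 11`, each given by the list of its faces, a face being
the cyclic list of its nodes. In the order of the list: the contact graphs of the face-centered
cubic and of the hexagonal-close packing, one with six triangles and seven quadrilaterals,
four with seven triangles, five quadrilaterals and one pentagon, and the hexagonal antiprism. -/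
def contactFaces : Fin 8 → List (List (Fin 12)) :=
  ![[[0, 1, 2, 3], [5, 1, 4, 6], [7, 2, 5, 8], [4, 0, 9, 10], [8, 6, 10, 11], [3, 7, 11, 9],
      [1, 0, 4], [2, 1, 5], [3, 2, 7], [8, 5, 6], [0, 3, 9], [6, 4, 10], [7, 8, 11], [10, 9, 11]],
    [[0, 1, 2, 3], [5, 1, 4, 6], [7, 2, 5, 8], [0, 3, 9, 10], [6, 4, 10, 11], [7, 8, 11, 9],
      [1, 0, 4], [2, 1, 5], [3, 2, 7], [8, 5, 6], [4, 0, 10], [8, 6, 11], [3, 7, 9], [10, 9, 11]],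
    [[0, 1, 2, 3], [5, 1, 4, 6], [7, 2, 5, 8], [8, 5, 6, 9], [0, 3, 10, 11], [6, 4, 11, 9],
      [8, 9, 10, 7], [1, 0, 4], [2, 1, 5], [3, 2, 7], [4, 0, 11], [10, 3, 7], [9, 11, 10]],
    [[0, 1, 2, 3, 4], [7, 2, 6, 8], [8, 6, 5, 9], [9, 5, 0, 10], [4, 3, 11, 10], [8, 9, 11, 7],
      [1, 0, 5], [2, 1, 6], [6, 1, 5], [3, 2, 7], [10, 0, 4], [9, 10, 11], [3, 7, 11]],
    [[0, 1, 2, 3, 4], [6, 1, 5, 7], [8, 2, 6, 9], [4, 3, 8, 10], [10, 9, 7, 11], [0, 4, 11, 5],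
      [1, 0, 5], [2, 1, 6], [3, 2, 8], [9, 6, 7], [10, 8, 9], [4, 10, 11], [7, 5, 11]],
    [[0, 1, 2, 3, 4], [6, 1, 5, 7], [3, 2, 6, 8], [9, 3, 8, 10], [10, 7, 5, 11], [4, 9, 11, 0],
      [1, 0, 5], [2, 1, 6], [8, 6, 7], [4, 3, 9], [10, 8, 7], [9, 10, 11], [5, 0, 11]],
    [[0, 1, 2, 3, 4], [2, 1, 5, 6], [3, 2, 7, 8], [0, 4, 9, 10], [6, 5, 10, 11], [8, 7, 11, 9],
      [1, 0, 5], [7, 2, 6], [4, 3, 8], [5, 0, 10], [7, 6, 11], [4, 8, 9], [10, 9, 11]],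
    [[0, 1, 2, 3, 4, 5], [8, 7, 6, 9, 10, 11], [1, 0, 6], [2, 1, 7], [7, 1, 6], [3, 2, 8],
      [8, 2, 7], [3, 8, 11], [4, 3, 11], [9, 6, 0], [4, 11, 10], [5, 4, 10], [9, 0, 5],
      [10, 9, 5]]]

/-- The darts of the `i`-th graph: its adjacent ordered pairs of nodes. -/
def IsContactDart (i : Fin 8) (p : Fin 12 × Fin 12) : Prop :=
  p ∈ (contactFaces i).flatMap faceDarts

instance (i : Fin 8) (p : Fin 12 × Fin 12) : Decidable (IsContactDart i p) :=
  inferInstanceAs (Decidable (_ ∈ _))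

set_option maxRecDepth 100000 in
theorem isContactDart_swapPerm : ∀ (i : Fin 8) (p : Fin 12 × Fin 12),
    IsContactDart i (swapPerm p) ↔ IsContactDart i p := by
  decide +kernel

set_option maxRecDepth 100000 in
theorem isContactDart_facePerm : ∀ (i : Fin 8) (p : Fin 12 × Fin 12),
    IsContactDart i (facePerm (contactFaces i) p) ↔ IsContactDart i p := by
  decide +kernel

/-- The eight hypermaps of the list: `e` reverses a dart, `f` moves a dart to the next dart of
its face, and `n` is determined by `e n f = 1`. -/
def contactHypermap (i : Fin 8) : Hypermap {p : Fin 12 × Fin 12 // IsContactDart i p} where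
  e := swapPerm.subtypePerm (isContactDart_swapPerm i)
  n := (swapPerm.subtypePerm (isContactDart_swapPerm i))⁻¹ *
    ((facePerm (contactFaces i)).subtypePerm (isContactDart_facePerm i))⁻¹
  f := (facePerm (contactFaces i)).subtypePerm (isContactDart_facePerm i)
  enf := by group

/-!
The conditions on weights are used only to restrict the sizes of faces and the types of nodes. The
sum of the bounds `d₁` is below the target, there are twelve nodes, and they have at most four
darts each. With Euler's formula this leaves twelve lists of numbers of faces
(`Hypermap.HasTameContact.faceNumbers_cases`): ten with 48 darts, where all nodes have exactly four
darts, and two with 46 darts. A node whose faces are triangles and quadrilaterals has type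
`(0, 3)`, `(1, 3)` or `(2, 2)`, because `b` is the target for all other types
(`Hypermap.HasTameContact.node_type`). Here it matters that such a face passes only once through a
node, so that its corners at the node correspond to its faces.

For each of the twelve lists, the hypermaps are found by an exhaustive search, which builds a
planar surface from polygons. A patch consists of some faces, glued along some of the edges
between them. Its boundary consists of circles, whose sides are the darts that are not yet glued.
In each step a side `x` is chosen. Its mate is either a dart of a face that is not in the patch, and
then this face is added, or a dart of the patch. In the second case the mate lies on the same
boundary circle as `x`, and the gluing splits this circle into two. This is the combinatorial
Jordan curve property `Hypermap.IsPlanar.sameCycle_of_compSetoid`: gluing two sides never decreases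
the genus, gluing sides of different circles of one component increases it, and the genus of a
planar hypermap is zero. All other choices are discarded as soon as the faces of some size are used
up, or the corners that are joined at a node do not belong to an admissible type. The lemma
`PatchSearch.searchFrom_sound` states that the search finds every hypermap with the given
numbers of faces and admissible nodes.

A complete patch determines the hypermap. It is compared with the tables of the edge and the face
map of the hypermaps of the list and of the opposites of the two among them that are chiral, by
extending a choice for the image of the dart `0` (`PatchSearch.isListed`). Most of the twelve
searches reach no complete patch with the right number of darts.

The searches are evaluated by the kernel. For its sake a set of small numbers or a table is
encoded by one natural number, the arithmetic is written with the functions that the kernel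
computes directly, functions are defined by recursors where this saves unfolding, and
`PatchSearch.force` has a number evaluated before it is copied.
-/

/-! ### Counting classes of equivalence relations and cycles of permutations -/

section Planarity

open Equiv Equiv.Perm

variable {D : Type*}

/-- The number of classes of an equivalence relation. -/
noncomputable def Setoid.numClasses (r : Setoid D) : ℕ := Nat.card (Quotient r)

open Classical in
/-- The class of a point, with the class of `y` replaced by the class of `x`. -/
noncomputable def Setoid.collapse (r : Setoid D) (x y a : D) : Quotient r :=
  if (⟦a⟧ : Quotient r) = ⟦y⟧ then ⟦x⟧ else ⟦a⟧

namespace Setoid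

variable {r s : Setoid D} {x y : D}

theorem collapse_congr {a b : D} (h : r a b) : r.collapse x y a = r.collapse x y b := by
  have : (⟦a⟧ : Quotient r) = ⟦b⟧ := Quotient.sound h
  unfold collapse
  rw [this]

theorem collapse_left : r.collapse x y x = ⟦x⟧ := by
  unfold collapse
  split_ifs <;> rfl

theorem collapse_right : r.collapse x y y = ⟦x⟧ := by
  simp [collapse]

/-- If `s` is coarser than `r` by at most the identification of `x` with `y`, then it has at
most one class less. -/
theorem numClasses_le_add_one [Finite D]
    (h : ∀ a b, s a b → r.collapse x y a = r.collapse x y b) :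
    r.numClasses ≤ s.numClasses + 1 := by
  classical
  let g : Quotient s → Quotient r := Quotient.lift (r.collapse x y) h
  have hcov : (Set.univ : Set (Quotient r)) ⊆ insert ⟦y⟧ (Set.range g) := by
    intro q _
    induction q using Quotient.inductionOn with
    | h a =>
      by_cases hq : (⟦a⟧ : Quotient r) = ⟦y⟧
      · exact Or.inl hq
      · exact Or.inr ⟨⟦a⟧, if_neg hq⟩
  calc r.numClasses = (Set.univ : Set (Quotient r)).ncard := (Set.ncard_univ _).symm
    _ ≤ (insert ⟦y⟧ (Set.range g)).ncard := Set.ncard_le_ncard hcov (Set.toFinite _)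
    _ ≤ (Set.range g).ncard + 1 := Set.ncard_insert_le _ _
    _ ≤ s.numClasses + 1 := by
      have : (Set.range g).ncard ≤ s.numClasses := by
        rw [← Set.image_univ]
        exact (Set.ncard_image_le (Set.toFinite _)).trans_eq (Set.ncard_univ _)
      omega

theorem numClasses_le_of_le [Finite D] (h : s ≤ r) : r.numClasses ≤ s.numClasses :=
  Nat.card_le_card_of_surjective (Quotient.map' id h) fun q => by
    induction q using Quotient.inductionOn with
    | h a => exact ⟨⟦a⟧, rfl⟩

theorem numClasses_add_one_le [Finite D] (h : r ≤ s) (hs : s x y) (hr : ¬ r x y) :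
    s.numClasses + 1 ≤ r.numClasses := by
  by_contra hlt
  have hsurj : Function.Surjective (Quotient.map' id h : Quotient r → Quotient s) := fun q => by
    induction q using Quotient.inductionOn with
    | h a => exact ⟨⟦a⟧, rfl⟩
  have hbij := hsurj.bijective_of_nat_card_le (by unfold numClasses at hlt; omega)
  exact hr (Quotient.eq.1 (hbij.1 (a₁ := ⟦x⟧) (a₂ := ⟦y⟧) (Quotient.sound hs)))

end Setoid

/-- The number of cycles of a permutation, fixed points included. -/
noncomputable def Equiv.Perm.numCycles (g : Perm D) : ℕ := (SameCycle.setoid g).numClasses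

theorem Equiv.Perm.SameCycle.apply_eq_of_invariant {X : Type*} {g : Perm D} {φ : D → X}
    (h : ∀ d, φ (g d) = φ d) {a b : D} (hab : g.SameCycle a b) : φ a = φ b := by
  have hn : ∀ (n : ℕ) d, φ ((g ^ n) d) = φ d := by
    intro n
    induction n with
    | zero => simp
    | succ n ih => intro d; rw [pow_succ, mul_apply, ih, h]
  obtain ⟨i, rfl⟩ := hab
  obtain ⟨n, rfl | rfl⟩ := i.eq_nat_or_neg
  · exact (hn n a).symm
  · conv_lhs => rw [show a = (g ^ n) ((g ^ (-(n : ℤ))) a) by simp]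
    exact hn n _

section Swap

variable [DecidableEq D] {g : Perm D} {x y : D}

theorem Equiv.Perm.numCycles_mul_swap_le [Finite D] :
    (g * swap x y).numCycles ≤ g.numCycles + 1 := by
  refine Setoid.numClasses_le_add_one (x := x) (y := y) fun a b hab => ?_
  refine SameCycle.apply_eq_of_invariant (g := g) (fun d => ?_) hab
  have hg : ∀ d, g d = (g * swap x y) (swap x y d) := fun d => by simp
  have hr : ∀ d, SameCycle.setoid (g * swap x y) ((g * swap x y) d) d := fun d =>
    (sameCycle_apply_left).2 (SameCycle.refl _ _)
  rw [hg d]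
  rw [Setoid.collapse_congr (hr _)]
  by_cases hx : d = x
  · subst hx; rw [swap_apply_left, Setoid.collapse_right, Setoid.collapse_left]
  by_cases hy : d = y
  · subst hy; rw [swap_apply_right, Setoid.collapse_right, Setoid.collapse_left]
  rw [swap_apply_of_ne_of_ne hx hy]

theorem Equiv.Perm.sameCycle_mul_swap [Finite D] (h : ¬ g.SameCycle x y) :
    (g * swap x y).SameCycle x y := by
  have hper : ∃ k, (g ^ (k + 1)) x = x := by
    obtain ⟨k, hk, hk'⟩ := (isOfFinOrder_of_finite g).exists_pow_eq_one
    exact ⟨k - 1, by rw [Nat.sub_add_cancel hk, hk']; rfl⟩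
  classical
  -- the cycle of `x` under `g` is traversed by `g * swap x y`, but it is entered from `y`
  let k := Nat.find hper
  have key : ∀ j ≤ k, (g * swap x y).SameCycle y ((g ^ (j + 1)) x) := by
    intro j
    induction j with
    | zero =>
      intro _
      refine ⟨1, ?_⟩
      simp
    | succ j ih =>
      intro hj
      have h1 : (g ^ (j + 1)) x ≠ x := Nat.find_min hper (m := j) hj
      have h2 : (g ^ (j + 1)) x ≠ y := fun h2 => h ⟨(j + 1 : ℕ), by rw [zpow_natCast]; exact h2⟩
      have h3 : (g ^ (j + 1 + 1)) x = (g * swap x y) ((g ^ (j + 1)) x) := by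
        rw [mul_apply, swap_apply_of_ne_of_ne h1 h2, pow_succ' g (j + 1), mul_apply]
      rw [h3, sameCycle_apply_right]
      exact ih (by omega)
  have := key k le_rfl
  rw [Nat.find_spec hper] at this
  exact this.symm

/-- Multiplying by a transposition of points in different cycles merges their cycles. -/
theorem Equiv.Perm.numCycles_mul_swap_add_one_le [Finite D] (h : ¬ g.SameCycle x y) :
    (g * swap x y).numCycles + 1 ≤ g.numCycles := by
  have hxy := sameCycle_mul_swap h
  refine Setoid.numClasses_add_one_le (x := x) (y := y) (fun a b hab => ?_) hxy h
  suffices hq : (⟦a⟧ : Quotient (SameCycle.setoid (g * swap x y))) = ⟦b⟧ from Quotient.eq.1 hq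
  refine SameCycle.apply_eq_of_invariant (g := g) (fun d => ?_) hab
  refine Quotient.sound ?_
  change (g * swap x y).SameCycle (g d) d
  have hg : g d = (g * swap x y) (swap x y d) := by simp
  rw [hg, sameCycle_apply_left]
  by_cases hx : d = x
  · subst hx; rw [swap_apply_left]; exact hxy.symm
  by_cases hy : d = y
  · subst hy; rw [swap_apply_right]; exact hxy
  rw [swap_apply_of_ne_of_ne hx hy]

end Swap

/-! ### Gluing edges one at a time -/

/-- The relation of lying in the same orbit of the group generated by `a` and `f`. -/
def compSetoid (a f : Perm D) : Setoid D :=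
  Relation.EqvGen.setoid fun x y => y = a x ∨ y = f x

theorem compSetoid_apply_left (a f : Perm D) (x : D) : compSetoid a f x (a x) :=
  .rel _ _ (Or.inl rfl)

theorem compSetoid_apply_right (a f : Perm D) (x : D) : compSetoid a f x (f x) :=
  .rel _ _ (Or.inr rfl)

theorem compSetoid.apply_eq_of_invariant {X : Type*} {a f : Perm D} {φ : D → X}
    (ha : ∀ d, φ (a d) = φ d) (hf : ∀ d, φ (f d) = φ d) {x y : D} (h : compSetoid a f x y) :
    φ x = φ y := by
  induction h with
  | rel x y h => rcases h with rfl | rfl <;> simp [ha, hf]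
  | refl => rfl
  | symm _ _ _ ih => exact ih.symm
  | trans _ _ _ _ _ ih1 ih2 => exact ih1.trans ih2

theorem sameCycle_mul_le_compSetoid {a f : Perm D} {x y : D} (h : (f * a).SameCycle x y) :
    compSetoid a f x y := by
  refine Quotient.eq.1 (h.apply_eq_of_invariant (φ := fun d => (⟦d⟧ : Quotient (compSetoid a f)))
    fun d => Quotient.sound ?_)
  exact (compSetoid _ _).symm'
    ((compSetoid_apply_left a f d).trans _ _ _ (compSetoid_apply_right a f (a d)))

/-- Twice the genus, summed over the components, of the surface obtained from the disjoint
polygons that are the cycles of `f` by gluing their sides along the involution `a`; a fixed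
point of `a` is a side that is not glued, and every boundary circle is filled by a disc. -/
noncomputable def twiceGenus (a f : Perm D) : ℤ :=
  2 * (compSetoid a f).numClasses + Nat.card D - a.numCycles - f.numCycles - (f * a).numCycles

theorem twiceGenus_one [Finite D] (f : Perm D) : twiceGenus 1 f = 0 := by
  have h1 : compSetoid 1 f = SameCycle.setoid f := by
    ext x y
    refine ⟨fun h => ?_, fun h => ?_⟩
    · refine Quotient.eq.1 (compSetoid.apply_eq_of_invariant
        (φ := fun d => (⟦d⟧ : Quotient (SameCycle.setoid f))) (fun _ => rfl)
        (fun d => Quotient.sound ?_) h)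
      exact sameCycle_apply_left.2 (SameCycle.refl _ _)
    · exact sameCycle_mul_le_compSetoid (by rwa [mul_one])
  have h2 : (1 : Perm D).numCycles = Nat.card D := by
    refine (Nat.card_congr (Equiv.ofBijective
      (fun d : D => (⟦d⟧ : Quotient (SameCycle.setoid (1 : Perm D)))) ⟨fun a b h => ?_,
        fun q => ?_⟩)).symm
    · have : (1 : Perm D).SameCycle a b := Quotient.eq.1 h
      simpa using this
    · induction q using Quotient.inductionOn with
      | h a => exact ⟨a, rfl⟩
  have h3 : (SameCycle.setoid f).numClasses = f.numCycles := rfl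
  rw [twiceGenus, h1, h2, h3, mul_one]
  ring

section Glue

variable [Finite D] [DecidableEq D] {a f : Perm D} {x y : D}

theorem numClasses_compSetoid_mul_swap (hx : a x = x) (hy : a y = y) :
    (compSetoid a f).numClasses ≤ (compSetoid (a * swap x y) f).numClasses + 1 ∧
    (compSetoid a f x y →
      (compSetoid a f).numClasses ≤ (compSetoid (a * swap x y) f).numClasses) := by
  have h1 : ∀ u v, compSetoid (a * swap x y) f u v →
      (compSetoid a f).collapse x y u = (compSetoid a f).collapse x y v := by
    intro u v huv
    refine compSetoid.apply_eq_of_invariant (fun d => ?_) (fun d => ?_) huv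
    · by_cases h : d = x
      · subst h
        rw [mul_apply, swap_apply_left, hy, Setoid.collapse_right, Setoid.collapse_left]
      by_cases h' : d = y
      · subst h'
        rw [mul_apply, swap_apply_right, hx, Setoid.collapse_right, Setoid.collapse_left]
      rw [mul_apply, swap_apply_of_ne_of_ne h h']
      exact Setoid.collapse_congr ((compSetoid a f).symm' (compSetoid_apply_left a f d))
    · exact Setoid.collapse_congr ((compSetoid a f).symm' (compSetoid_apply_right a f d))
  refine ⟨Setoid.numClasses_le_add_one h1, fun hxy => Setoid.numClasses_le_of_le ?_⟩
  intro u v huv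
  have h2 : ∀ u, (compSetoid a f).collapse x y u = ⟦u⟧ := by
    intro u
    unfold Setoid.collapse
    split_ifs with h
    · rw [h]; exact Quotient.sound hxy
    · rfl
  have h3 := h1 u v huv
  rw [h2, h2] at h3
  exact Quotient.eq.1 h3

/-- Gluing two sides does not decrease the genus, and it increases the genus if the two sides
lie in one component but on different boundary circles. -/
theorem twiceGenus_mul_swap (hxy : x ≠ y) (hx : a x = x) (hy : a y = y) :
    twiceGenus a f ≤ twiceGenus (a * swap x y) f ∧
    (compSetoid a f x y → ¬ (f * a).SameCycle x y →
      twiceGenus a f + 2 ≤ twiceGenus (a * swap x y) f) := by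
  have hc := numClasses_compSetoid_mul_swap (f := f) hx hy
  have ha : (a * swap x y).numCycles + 1 ≤ a.numCycles := by
    refine numCycles_mul_swap_add_one_le fun h => hxy ?_
    exact (h.eq_of_left hx)
  have h1 : (f * a * swap x y).numCycles ≤ (f * a).numCycles + 1 := numCycles_mul_swap_le
  have h2 : ¬ (f * a).SameCycle x y → (f * a * swap x y).numCycles + 1 ≤ (f * a).numCycles :=
    numCycles_mul_swap_add_one_le
  simp only [twiceGenus, ← mul_assoc]
  constructor
  · by_cases hcomp : compSetoid a f x y
    · have := hc.2 hcomp
      omega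
    · have := h2 fun h => hcomp (sameCycle_mul_le_compSetoid h)
      have := hc.1
      omega
  · intro hcomp hs
    have := hc.2 hcomp
    have := h2 hs
    omega

end Glue

/-- `a` is a partial version of the involution `e`: it agrees with `e` where it moves points. -/
def IsPartialGluing (a e : Perm D) : Prop := ∀ d, a d = d ∨ a d = e d

theorem IsPartialGluing.fixed_apply {a e : Perm D} (h : IsPartialGluing a e)
    (he : ∀ d, e (e d) = d) {x : D} (hx : a x = x) : a (e x) = e x := by
  rcases h (e x) with h1 | h1
  · exact h1
  · rw [he] at h1
    rw [a.injective (h1.trans hx.symm), hx]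

theorem IsPartialGluing.mul_swap [DecidableEq D] {a e : Perm D} (h : IsPartialGluing a e)
    (he : ∀ d, e (e d) = d) {x : D} (hx : a x = x) : IsPartialGluing (a * swap x (e x)) e := by
  intro d
  by_cases h1 : d = x
  · subst h1; right; rw [mul_apply, swap_apply_left, h.fixed_apply he hx]
  by_cases h2 : d = e x
  · subst h2; right; rw [mul_apply, swap_apply_right, hx, he]
  rw [mul_apply, swap_apply_of_ne_of_ne h1 h2]
  exact h d

/-- Gluing the remaining edges one at a time does not decrease the genus. -/
theorem twiceGenus_mono [Finite D] {a e : Perm D} (f : Perm D) (he : ∀ d, e (e d) = d)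
    (h : IsPartialGluing a e) : twiceGenus a f ≤ twiceGenus e f := by
  classical
  induction hn : {d | a d ≠ e d}.ncard using Nat.strong_induction_on generalizing a with
  | _ n ih =>
    by_cases hae : a = e
    · rw [hae]
    obtain ⟨x, hx⟩ : ∃ x, a x ≠ e x := by
      by_contra hcon
      push Not at hcon
      exact hae (Equiv.ext hcon)
    have hax : a x = x := (h x).resolve_right hx
    have hne : x ≠ e x := fun h' => hx (hax.trans h')
    have hay := h.fixed_apply he hax
    refine (twiceGenus_mul_swap (f := f) hne hax hay).1.trans
      (ih _ ?_ (h.mul_swap he hax) rfl)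
    rw [← hn]
    refine Set.ncard_lt_ncard ⟨fun d hd => ?_, fun hsub => ?_⟩ (Set.toFinite _)
    · intro hd'
      refine hd ?_
      by_cases h1 : d = x
      · exact absurd hd' (h1 ▸ hx)
      by_cases h2 : d = e x
      · subst h2
        rw [mul_apply, swap_apply_right, hax, he]
      rw [mul_apply, swap_apply_of_ne_of_ne h1 h2, hd']
    · refine hsub hx ?_
      rw [mul_apply, swap_apply_left, hay]

namespace Hypermap

variable {H : Hypermap D}

theorem n_eq (H : Hypermap D) : H.n = (H.f * H.e)⁻¹ := by
  have h := H.enf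
  rw [eq_inv_iff_mul_eq_one]
  have : H.n * H.f = H.e⁻¹ := eq_inv_of_mul_eq_one_right (by rw [← mul_assoc]; exact h)
  rw [← mul_assoc, this, inv_mul_cancel]

theorem sameCycle_n_iff {x y : D} : H.n.SameCycle x y ↔ (H.f * H.e).SameCycle x y := by
  rw [n_eq, sameCycle_inv]

theorem compSetoid_of_isConnected (hH : H.IsConnected) (x y : D) : compSetoid H.e H.f x y := by
  obtain ⟨g, hg, rfl⟩ := hH.2 x y
  have hinv : ∀ (p : Perm D), (∀ d, compSetoid H.e H.f d (p d)) →
      ∀ d, compSetoid H.e H.f d (p⁻¹ d) := fun p hp d => by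
    have := hp (p⁻¹ d)
    rw [Equiv.Perm.coe_inv, Equiv.apply_symm_apply] at this
    exact (compSetoid _ _).symm' this
  have hef : ∀ d, compSetoid H.e H.f d ((H.f * H.e) d) := fun d =>
    (compSetoid_apply_left _ _ d).trans _ _ _ (compSetoid_apply_right _ _ _)
  suffices h : ∀ d, compSetoid H.e H.f d (g d) from h x
  induction hg using Subgroup.closure_induction with
  | mem g hg =>
    rcases hg with rfl | rfl | rfl
    · exact compSetoid_apply_left _ _
    · rw [n_eq]; exact hinv _ hef
    · exact compSetoid_apply_right _ _
  | one => exact fun d => (compSetoid _ _).refl' d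
  | mul p q _ _ hp hq => exact fun d => (hq d).trans _ _ _ (hp _)
  | inv p _ hp => exact hinv p hp

theorem twiceGenus_eq_zero [Finite D] (hH : H.IsPlanar) : twiceGenus H.e H.f = 0 := by
  have hc : (compSetoid H.e H.f).numClasses = 1 := by
    obtain ⟨⟨x⟩, -⟩ := hH.1
    refine Nat.card_eq_one_iff_unique.2 ⟨⟨fun p q => ?_⟩, ⟨⟦x⟧⟩⟩
    induction p using Quotient.inductionOn with
    | h a => induction q using Quotient.inductionOn with
      | h b => exact Quotient.sound (compSetoid_of_isConnected hH.1 a b)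
  have hn : (H.f * H.e).numCycles = Nat.card H.Node := by
    have : SameCycle.setoid (H.f * H.e) = SameCycle.setoid H.n :=
      Setoid.ext fun a b => (sameCycle_n_iff (H := H)).symm
    rw [numCycles, this]
    rfl
  have hE : H.e.numCycles = Nat.card H.Edge := rfl
  have hF : H.f.numCycles = Nat.card H.Face := rfl
  have := hH.2
  rw [twiceGenus, hc, hn, hE, hF]
  omega

/-- The combinatorial Jordan curve property: if the surface glued so far from the faces of a
planar hypermap contains the two sides of an edge in one component, then these two sides lie on
the same boundary circle. -/
theorem IsPlanar.sameCycle_of_compSetoid [Finite D] (hH : H.IsPlanar) (hp : H.IsPlain)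
    {a : Perm D} (ha : IsPartialGluing a H.e) {x : D} (hx : a x = x) (hne : H.e x ≠ x)
    (hc : compSetoid a H.f x (H.e x)) : (H.f * a).SameCycle x (H.e x) := by
  classical
  by_contra hs
  have h1 := (twiceGenus_mul_swap (f := H.f) hne.symm hx (ha.fixed_apply hp hx)).2 hc hs
  have h2 := twiceGenus_mono H.f hp (ha.mul_swap hp hx)
  have h3 := twiceGenus_mono (a := 1) (e := a) H.f (fun d => by
    rcases ha d with h | h
    · rw [h, h]
    · by_cases hd : a d = d
      · rw [hd, hd]
      · rcases ha (a d) with h' | h'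
        · exact absurd (a.injective h') hd
        · rw [h', h, hp]) fun d => Or.inl rfl
  -- gluing `x` to `e x` would raise the genus from at least `0`, while it is `0` in the end
  rw [twiceGenus_one] at h3
  rw [twiceGenus_eq_zero hH] at h2
  omega

end Hypermap

end Planarity

/-! ### The search -/

namespace PatchSearch

/-- A boundary circle of a patch of faces, as the cyclic list of its sides. A side comes with the
code of the sequence of corners of the patch that lie between the preceding side and it. -/
abbrev Circle := List (ℕ × ℕ)

/-- The type of a node (or of a part of it) is encoded by the sum of the codes of its corners:
with `p` triangles, `q` quadrilaterals and `r` larger faces the code is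
`64 * (p + q + r) + 8 * p + q`. -/
def sizeCode (k : ℕ) : ℕ := bif Nat.beq k 3 then 72 else bif Nat.beq k 4 then 65 else 64

/-- Membership in a set of natural numbers that is given by its bits. -/
def bit (mask c : ℕ) : Bool := Nat.beq (Nat.land (Nat.shiftRight mask c) 1) 1

/-- The admissible codes of a node, `complete`, and of a part of a node, `incomplete`. -/
structure NodeTable where
  complete : ℕ
  incomplete : ℕ

/-- This is `k n`, in a form which has the kernel evaluate `n` before `k n`. -/
def force (n : ℕ) (k : ℕ → Bool) : Bool :=
  match n with
  | 0 => k 0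
  | i + 1 => k (i + 1)

/-- The position of the largest code in a list whose first entry has position `j`, if this code
is larger than `b`, and `i` otherwise. -/
noncomputable def maxPos (b i j : ℕ) (l : Circle) : ℕ :=
  List.rec (motive := fun _ => ℕ → ℕ → ℕ → ℕ) (fun _ i _ => i)
    (fun s _ ih b i j =>
      cond (Nat.ble s.2 b) (ih b i (Nat.add j 1)) (ih s.2 j (Nat.add j 1))) l b i j

/-- Whether the corners with code `c` may be joined to those before the first side of `l`; if `l`
is empty, the corners with code `c` make up a whole node. -/
noncomputable def okHead (P : NodeTable) (c : ℕ) (l : Circle) : Bool :=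
  List.rec (bit P.complete c) (fun s _ _ => bit P.incomplete (Nat.add s.2 c)) l

/-- Join the corners with code `c` to those before the first side of `l`. -/
def addHead (c : ℕ) : Circle → Circle
  | [] => []
  | (z, d) :: l => (z, Nat.add d c) :: l

/-- The sides `m + 2, …, m + i + 1` of a new face with corner code `w`, followed by `l`. -/
def faceTail (m w : ℕ) : ℕ → Circle → Circle
  | 0, l => l
  | i + 1, l => faceTail m w i ((Nat.add m (Nat.add i 2), w) :: l)

/-- A predicate on the states of the search. The arguments are the boundary circles of the patch;
the numbers of faces of sizes `3, 4, …` that are not in the patch; the number of darts of the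
patch; the pairs of glued darts; the faces of the patch, each given by its first dart and its
size (the darts of a face have successive numbers). -/
abbrev StatePred := List Circle → List ℕ → ℕ → List (ℕ × ℕ) → List (ℕ × ℕ) → Bool

/-- The conjunction, by a recursor, which the kernel reduces at once. -/
abbrev both (a b : Bool) : Bool := Bool.rec false b a

/-- The implication, by a recursor, which the kernel reduces at once. -/
abbrev implies (a b : Bool) : Bool := Bool.rec true b a

/-- Glue the side `x`, which is followed on its circle by the sides in `l`, to each of the sides in
the final part `C` of `l`, which starts at position `j`. The test on `j` decides whether
`l.take j` is empty. -/
noncomputable def glueAll (P : NodeTable) (ih : List Circle → List (ℕ × ℕ) → Bool)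
    (st : List Circle) (gl : List (ℕ × ℕ)) (x cx : ℕ) (l : Circle) (j : ℕ) (C : Circle) : Bool :=
  List.rec (motive := fun _ => ℕ → Bool) (fun _ => true)
    (fun y C r j => both
      (implies (okHead P cx C)
        (implies (Nat.rec (bit P.complete y.2) (fun _ _ => okHead P y.2 l) j)
          (ih (addHead cx C :: addHead y.2 (l.take j) :: st) ((x, y.1) :: gl))))
      (r (Nat.add j 1))) C j

/-- Glue a new face of size `k` to the side `x`, which is followed on its circle by the sides
in `l`. -/
noncomputable def addFace (P : NodeTable) (ih : StatePred) (st : List Circle) (rem : List ℕ) (m : ℕ)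
    (gl fl : List (ℕ × ℕ)) (x cx : ℕ) (l : Circle) (k : ℕ) : Bool :=
  force (rem.getD (Nat.sub k 3) 0) fun r =>
    implies (Nat.blt 0 r) (implies (bit P.incomplete (Nat.add cx (sizeCode k)))
      (implies (okHead P (sizeCode k) l) (force (sizeCode k) fun w => force (Nat.add m k) fun m' =>
        ih (((Nat.add m 1, Nat.add cx w) :: faceTail m w (Nat.sub k 2) (addHead w l)) :: st)
          (rem.set (Nat.sub k 3) (Nat.sub r 1)) m' ((x, m) :: gl) ((m, k) :: fl))))

/-- One step of the search: choose the side `x` of the first circle with the largest code, and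
glue every possible side of the circle and every possible face to it. Nothing remains to be done
for a circle without sides, and a circle with a single side would be a loop. -/
noncomputable def step (P : NodeTable) (leaf : ℕ → List (ℕ × ℕ) → List (ℕ × ℕ) → Bool)
    (ih : StatePred) : StatePred
  | [], _, m, gl, fl => leaf m gl fl
  | cyc :: st, rem, m, gl, fl =>
    match List.append (cyc.drop (maxPos 0 0 0 cyc)) (cyc.take (maxPos 0 0 0 cyc)) with
    | [] => ih st rem m gl fl
    | (x, cx) :: l =>
      match l with
      | [] => true
      | _ => both (glueAll P (fun s g => ih s rem m g fl) st gl x cx l 0 l)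
          (both (addFace P ih st rem m gl fl x cx l 3) (both (addFace P ih st rem m gl fl x cx l 4)
          (both (addFace P ih st rem m gl fl x cx l 5) (both (addFace P ih st rem m gl fl x cx l 6)
          (both (addFace P ih st rem m gl fl x cx l 7) (addFace P ih st rem m gl fl x cx l 8))))))

/-- The search in `n` steps, followed by the test `base` of the states that are reached; complete
states are tested by `leaf` as soon as they are reached. -/
noncomputable def searchThen (P : NodeTable) (leaf : ℕ → List (ℕ × ℕ) → List (ℕ × ℕ) → Bool)
    (base : StatePred) : ℕ → StatePred
  | 0 => base
  | n + 1 => step P leaf (searchThen P leaf base n)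

/-- Part `i` of `M` of the search that starts with a single face of size `k`: the states after
seven steps are distributed over the `M` parts by a number that is computed from the pairs of
glued darts. Small parts limit the memory that the kernel needs for one of them. The bound 80 on
the number of further steps is generous; reaching it would make the search fail. -/
noncomputable def searchFrom (P : NodeTable) (leaf : ℕ → List (ℕ × ℕ) → List (ℕ × ℕ) → Bool)
    (k : ℕ) (faces : List ℕ) (M i : ℕ) : Bool :=
  searchThen P leaf
    (fun cs rem m gl fl => implies (Nat.beq (Nat.mod (gl.map Prod.snd).sum M) i)
      (searchThen P leaf (fun _ _ _ _ _ => false) 80 cs rem m gl fl)) 7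
    [(0, sizeCode k) :: (1, sizeCode k) :: faceTail 0 (sizeCode k) (k - 2) []]
    (faces.set (k - 3) (faces.getD (k - 3) 0 - 1)) k [] [(0, k)]

theorem both_eq_true {a b : Bool} (h : both a b = true) : a = true ∧ b = true := by
  cases a
  · exact absurd h (by simp)
  · exact ⟨rfl, h⟩

theorem of_implies {a b : Bool} (h : implies a b = true) (ha : a = true) : b = true := by
  subst ha
  exact h

theorem force_eq (n : ℕ) (k : ℕ → Bool) : force n k = k n := by
  cases n <;> rfl

theorem bit_eq_false {mask c n : ℕ} (hm : mask < 2 ^ n) (hc : n ≤ c) : bit mask c = false := by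
  have h : mask >>> c = 0 := by
    rw [Nat.shiftRight_eq_div_pow]
    exact Nat.div_eq_of_lt (hm.trans_le (Nat.pow_le_pow_right (by norm_num) hc))
  change Nat.beq (Nat.land (mask >>> c) 1) 1 = false
  rw [h]
  rfl

theorem glueAll_spec {P : NodeTable} {ih : List Circle → List (ℕ × ℕ) → Bool}
    {st : List Circle} {gl : List (ℕ × ℕ)} {x cx : ℕ} {l B C : Circle} {y cy : ℕ}
    (h : glueAll P ih st gl x cx l 0 l = true) (hl : l = B ++ (y, cy) :: C)
    (h1 : okHead P cx C = true) (h2 : okHead P cy B = true) :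
    ih (addHead cx C :: addHead cy B :: st) ((x, y) :: gl) = true := by
  have key : ∀ (B' : Circle) (l' : Circle) (j : ℕ), l' = B' ++ (y, cy) :: C →
      l.take (j + B'.length) = B → glueAll P ih st gl x cx l j l' = true →
      ih (addHead cx C :: addHead cy B :: st) ((x, y) :: gl) = true := by
    intro B'
    induction B' with
    | nil =>
      rintro l' j rfl hj hg
      have hj : l.take j = B := hj
      have hg : both (implies (okHead P cx C)
        (implies (Nat.rec (bit P.complete cy) (fun _ _ => okHead P cy l) j)
          (ih (addHead cx C :: addHead cy (l.take j) :: st) ((x, y) :: gl))))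
        (glueAll P ih st gl x cx l (j + 1) C) = true := hg
      rw [hj] at hg
      refine of_implies (of_implies (both_eq_true hg).1 h1) ?_
      subst hj
      cases j with
      | zero => exact h2
      | succ j => cases l <;> exact h2
    | cons b B' hB =>
      rintro l' j rfl hj hg
      have hg : both _ (glueAll P ih st gl x cx l (j + 1) (B' ++ (y, cy) :: C)) = true := hg
      refine hB _ (j + 1) rfl ?_ (both_eq_true hg).2
      rw [← hj, List.length_cons]
      congr 1
      omega
  exact key B l 0 hl (by rw [hl]; simp) h

end PatchSearch

/-! ### Corners at a node -/

section Nodes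

open Equiv Equiv.Perm PatchSearch

variable {D : Type*}

namespace Hypermap

/-- The number of darts of the face of a dart. -/
noncomputable def faceSize (H : Hypermap D) (d : D) : ℕ := (PermOrbit.of H.f d).darts.ncard

/-- The code of the corner at a dart. -/
noncomputable def cornerCode (H : Hypermap D) (d : D) : ℕ := sizeCode (H.faceSize d)

open Classical in
/-- The code of all corners at the node of a dart. -/
noncomputable def nodeCode [Fintype D] (H : Hypermap D) (d : D) : ℕ :=
  ∑ x with (H.f * H.e).SameCycle d x, H.cornerCode x

/-- `NodePath H a d z c`: the corners from `d` to `z` at a node are consecutive in the patch that is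
glued along `a`, the side `z` is not glued, and `c` is the code of these corners. -/
inductive NodePath (H : Hypermap D) (a : Perm D) : D → D → ℕ → Prop
  | last {z : D} : a z = z → NodePath H a z z (H.cornerCode z)
  | step {d z : D} {c : ℕ} : a d ≠ d → NodePath H a (H.f (a d)) z c →
      NodePath H a d z (c + H.cornerCode d)

namespace NodePath

variable {H : Hypermap D} {a a' : Perm D} {d z u : D} {c c' : ℕ}

theorem apply_last (h : H.NodePath a d z c) : a z = z := by
  induction h with
  | last h => exact h
  | step _ _ ih => exact ih

theorem eq_of_fixed (h : H.NodePath a d z c) (hd : a d = d) : d = z := by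
  cases h with
  | last => rfl
  | step h => exact absurd hd h

theorem mono (h : H.NodePath a d z c) (haa : ∀ x, a x ≠ x → a' x = a x) (hz : a' z = z) :
    H.NodePath a' d z c := by
  induction h with
  | last => exact last hz
  | step hd _ ih =>
    have := haa _ hd
    refine step (by rw [this]; exact hd) ?_
    rw [this]
    exact ih hz

/-- When the side at the end of a path is glued, the path continues. -/
theorem trans (h : H.NodePath a d z c) (haa : ∀ x, a x ≠ x → a' x = a x) (hz : a' z ≠ z)
    (h' : H.NodePath a' (H.f (a' z)) u c') : H.NodePath a' d u (c' + c) := by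
  induction h with
  | last => exact step hz h'
  | step hd _ ih =>
    have := haa _ hd
    rw [← add_assoc]
    refine step (by rw [this]; exact hd) ?_
    rw [this]
    exact ih hz h'

theorem exists_pow (h : H.NodePath a d z c) (ha : IsPartialGluing a H.e) :
    ∃ n : ℕ, ((H.f * H.e) ^ n) d = z ∧
      (∀ i < n, a (((H.f * H.e) ^ i) d) ≠ ((H.f * H.e) ^ i) d) ∧
      c = ∑ i ∈ Finset.range (n + 1), H.cornerCode (((H.f * H.e) ^ i) d) := by
  induction h with
  | last => exact ⟨0, rfl, by simp, by simp⟩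
  | @step d z c hd _ ih =>
    obtain ⟨n, h1, h2, h3⟩ := ih
    have hd' : H.f (a d) = (H.f * H.e) d := by rw [(ha d).resolve_left hd]; rfl
    have hp : ∀ i, ((H.f * H.e) ^ i) (H.f (a d)) = ((H.f * H.e) ^ (i + 1)) d := fun i => by
      rw [hd', pow_succ, mul_apply _ (H.f * H.e)]
    refine ⟨n + 1, by rw [← hp, h1], fun i hi => ?_, ?_⟩
    · cases i with
      | zero => exact hd
      | succ i => rw [← hp]; exact h2 i (by omega)
    · rw [Finset.sum_range_succ', h3]
      simp only [hp]
      rfl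

theorem sameCycle (h : H.NodePath a d z c) (ha : IsPartialGluing a H.e) :
    (H.f * H.e).SameCycle d z := by
  obtain ⟨n, h1, -⟩ := h.exists_pow ha
  exact ⟨n, by rw [zpow_natCast]; exact h1⟩

/-- The corners of a path are distinct; if the path closes up, they are all corners of the node. -/
theorem exists_finset [Fintype D] (h : H.NodePath a d z c) (ha : IsPartialGluing a H.e) :
    ∃ s : Finset D, (∀ x ∈ s, (H.f * H.e).SameCycle d x) ∧ c = ∑ x ∈ s, H.cornerCode x ∧
      ((H.f * H.e) z = d → ∀ x, (H.f * H.e).SameCycle d x → x ∈ s) := by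
  classical
  have hz := h.apply_last
  obtain ⟨n, h1, h2, h3⟩ := h.exists_pow ha
  set g := H.f * H.e
  have hinj : Set.InjOn (fun i => (g ^ i) d) (Finset.range (n + 1) : Set ℕ) := by
    have aux : ∀ i j, i < j → j ≤ n → (g ^ i) d ≠ (g ^ j) d := by
      intro i j hij hj heq
      refine h2 (n - (j - i)) (by omega) ?_
      have : (g ^ (n - (j - i))) d = z := by
        rw [show n - (j - i) = (n - j) + i by omega, pow_add, mul_apply, heq, ← mul_apply,
          ← pow_add, show n - j + j = n by omega, h1]
      rw [this, hz]
    intro i hi j hj hij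
    simp only [Finset.coe_range, Set.mem_Iio] at hi hj
    rcases lt_trichotomy i j with hlt | heq | hlt
    · exact absurd hij (aux i j hlt (by omega))
    · exact heq
    · exact absurd hij.symm (aux j i hlt (by omega))
  refine ⟨(Finset.range (n + 1)).image fun i => (g ^ i) d, ?_, ?_, ?_⟩
  · intro x hx
    obtain ⟨i, -, rfl⟩ := Finset.mem_image.1 hx
    exact ⟨i, by rw [zpow_natCast]⟩
  · rw [Finset.sum_image hinj, h3]
  · intro hzd x hx
    obtain ⟨j, rfl⟩ := hx.exists_nat_pow_eq
    have hper : (g ^ (n + 1)) d = d := by rw [pow_succ', mul_apply, h1, hzd]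
    refine Finset.mem_image.2 ⟨j % (n + 1), Finset.mem_range.2 (Nat.mod_lt _ (by omega)), ?_⟩
    conv_rhs => rw [← Nat.mod_add_div j (n + 1), pow_add, mul_apply, pow_mul]
    congr 1
    have : ∀ m : ℕ, ((g ^ (n + 1)) ^ m) d = d := fun m => by
      induction m with
      | zero => rfl
      | succ m ih => rw [pow_succ, mul_apply, hper, ih]
    exact (this _).symm

theorem nodeCode_eq [Fintype D] (h : H.NodePath a d z c) (ha : IsPartialGluing a H.e)
    (hz : (H.f * H.e) z = d) : H.nodeCode d = c := by
  classical
  obtain ⟨s, h1, h2, h3⟩ := h.exists_finset ha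
  rw [h2, nodeCode]
  congr 1
  ext x
  simp only [Finset.mem_filter, Finset.mem_univ, true_and]
  exact ⟨h3 hz x, h1 x⟩

end NodePath

end Hypermap

/-- A table of node types is applicable to a hypermap if it contains the types of all nodes, and if
the table of incomplete types is closed under removing corners. -/
structure PatchSearch.NodeTable.Admits [Fintype D] (P : NodeTable) (H : Hypermap D) : Prop where
  nodeCode : ∀ d, bit P.complete (H.nodeCode d) = true
  incomplete_of_complete : ∀ c, bit P.complete c = true → bit P.incomplete c = true
  incomplete_of_add : ∀ c k, bit P.incomplete (c + sizeCode k) = true → bit P.incomplete c = true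

theorem Hypermap.NodePath.incomplete [Fintype D] {H : Hypermap D} {a : Perm D} {d z : D} {c : ℕ}
    {P : NodeTable} (hP : P.Admits H) (ha : IsPartialGluing a H.e) (h : H.NodePath a d z c) :
    bit P.incomplete c = true := by
  classical
  obtain ⟨s, h1, rfl, -⟩ := h.exists_finset ha
  have hall := hP.incomplete_of_complete _ (hP.nodeCode d)
  have key : ∀ t : Finset D, bit P.incomplete (∑ x ∈ s, H.cornerCode x + ∑ x ∈ t, H.cornerCode x)
      = true → bit P.incomplete (∑ x ∈ s, H.cornerCode x) = true := by
    intro t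
    induction t using Finset.induction_on with
    | empty => simp
    | insert x t hx ih =>
      intro h
      rw [Finset.sum_insert hx, add_comm (H.cornerCode x), ← add_assoc] at h
      exact ih (hP.incomplete_of_add _ _ h)
  refine key ((Finset.univ.filter ((H.f * H.e).SameCycle d)) \ s) ?_
  rw [add_comm, Finset.sum_sdiff]
  · exact hall
  · intro x hx
    simpa using h1 x hx

/-! ### Patches -/

namespace PatchSearch

variable {H : Hypermap D} {a a' : Perm D} {A A' : ℕ → D} {m m' : ℕ}

/-- `Arc H a A m b l b'`: the list `l` describes the part of a boundary circle of the patch glued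
along `a`, with darts `A 0, …, A (m - 1)`, from the corner `b` up to the corner `b'`. -/
def Arc (H : Hypermap D) (a : Perm D) (A : ℕ → D) (m : ℕ) : D → Circle → D → Prop
  | b, [], b' => b = b'
  | b, s :: l, b' => s.1 < m ∧ H.NodePath a b (A s.1) s.2 ∧ Arc H a A m (H.f (A s.1)) l b'

namespace Arc

theorem append {b b' : D} {l l' : Circle} :
    Arc H a A m b (l ++ l') b' ↔ ∃ u, Arc H a A m b l u ∧ Arc H a A m u l' b' := by
  induction l generalizing b with
  | nil => simp [Arc]
  | cons s l ih => simp [Arc, ih, and_assoc]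

theorem mono {b b' : D} {l : Circle} (h : Arc H a A m b l b') (hm : m ≤ m')
    (hA : ∀ i < m, A' i = A i) (haa : ∀ x, a x ≠ x → a' x = a x)
    (hl : ∀ i ∈ l.map Prod.fst, a' (A i) = A i) : Arc H a' A' m' b l b' := by
  induction l generalizing b with
  | nil => exact h
  | cons s l ih =>
    obtain ⟨h1, h2, h3⟩ := h
    refine ⟨h1.trans_le hm, ?_, ?_⟩
    · rw [hA _ h1]
      exact h2.mono haa (hl _ (by simp))
    · rw [hA _ h1]
      exact ih h3 fun i hi => hl i (by simp at hi ⊢; exact Or.inr hi)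

theorem lt {b b' : D} {l : Circle} (h : Arc H a A m b l b') : ∀ i ∈ l.map Prod.fst, i < m := by
  induction l generalizing b with
  | nil => simp
  | cons s l ih =>
    intro i hi
    rw [List.map_cons, List.mem_cons] at hi
    rcases hi with rfl | hi
    · exact h.1
    · exact ih h.2.2 i hi

theorem fixed {b b' : D} {l : Circle} (h : Arc H a A m b l b') :
    ∀ i ∈ l.map Prod.fst, a (A i) = A i := by
  induction l generalizing b with
  | nil => simp
  | cons s l ih =>
    intro i hi
    rw [List.map_cons, List.mem_cons] at hi
    rcases hi with rfl | hi
    · exact h.2.1.apply_last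
    · exact ih h.2.2 i hi

/-- Join a path to the beginning of an arc. -/
theorem addHead {b b' z : D} {l : Circle} {c : ℕ} (h : Arc H a' A m (H.f (a' z)) l b')
    (hl : l ≠ []) (hp : H.NodePath a b z c) (haa : ∀ x, a x ≠ x → a' x = a x) (hz : a' z ≠ z) :
    Arc H a' A m b (addHead c l) b' := by
  cases l with
  | nil => exact absurd rfl hl
  | cons s l => exact ⟨h.1, hp.trans haa hz h.2.1, h.2.2⟩

theorem next {b b' : D} {l : Circle} (h : Arc H a A m b l b') :
    ∀ i ∈ l.map Prod.fst, (∃ j ∈ l.map Prod.fst, ∃ c, H.NodePath a (H.f (A i)) (A j) c) ∨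
      H.f (A i) = b' := by
  induction l generalizing b with
  | nil => simp
  | cons s l ih =>
    intro i hi
    rw [List.map_cons, List.mem_cons] at hi
    rcases hi with rfl | hi
    · cases l with
      | nil => exact Or.inr h.2.2
      | cons t l => exact Or.inl ⟨t.1, by simp, t.2, h.2.2.2.1⟩
    · rcases ih h.2.2 i hi with ⟨j, hj, c, hc⟩ | h'
      · exact Or.inl ⟨j, by rw [List.map_cons]; exact List.mem_cons_of_mem _ hj, c, hc⟩
      · exact Or.inr h'

/-- A closed arc through an unglued side `x` contains all unglued sides on its boundary circle. -/
theorem exists_mem [Finite D] {b : D} {s : ℕ × ℕ} {l : Circle}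
    (h : Arc H a A m b (s :: l) b) {y : D} (hy : a y = y)
    (hc : (H.f * a).SameCycle (A s.1) y) : ∃ j ∈ (s :: l).map Prod.fst, y = A j := by
  have key : ∀ n : ℕ, ∃ j ∈ (s :: l).map Prod.fst, ∃ c,
      H.NodePath a (((H.f * a) ^ n) (A s.1)) (A j) c := by
    intro n
    induction n with
    | zero => exact ⟨s.1, by simp, _, .last h.2.1.apply_last⟩
    | succ n ih =>
      obtain ⟨j, hj, c, hp⟩ := ih
      rw [pow_succ', mul_apply, mul_apply]
      generalize ((H.f * a) ^ n) (A s.1) = d at hp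
      cases hp with
      | last hd =>
        rw [hd]
        rcases h.next j hj with h' | h'
        · exact h'
        · rw [h']
          exact ⟨s.1, by simp, _, h.2.1⟩
      | step hd hp => exact ⟨j, hj, _, hp⟩
  obtain ⟨n, rfl⟩ := hc.exists_nat_pow_eq
  obtain ⟨j, hj, c, hp⟩ := key n
  exact ⟨j, hj, hp.eq_of_fixed hy⟩

theorem faceTail {w b' : _} {l : Circle} (i : ℕ) (hm : m + i + 1 < m')
    (hf : ∀ j < i, H.f (A (m + j + 1)) = A (m + j + 2))
    (ha : ∀ j < i, a (A (m + j + 2)) = A (m + j + 2))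
    (hw : ∀ j < i, H.cornerCode (A (m + j + 2)) = w)
    (h : Arc H a A m' (H.f (A (m + i + 1))) l b') :
    Arc H a A m' (H.f (A (m + 1))) (faceTail m w i l) b' := by
  induction i generalizing l with
  | zero => exact h
  | succ i ih =>
    refine ih (by omega) (fun j hj => hf j (by omega)) (fun j hj => ha j (by omega))
      (fun j hj => hw j (by omega)) ⟨?_, ?_, h⟩
    · change m + (i + 2) < m'
      omega
    · change H.NodePath a _ (A (m + (i + 2))) w
      rw [← hw i (by omega), hf i (by omega)]
      exact .last (ha i (by omega))

end Arc

theorem map_fst_addHead (c : ℕ) (l : Circle) :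
    (addHead c l).map Prod.fst = l.map Prod.fst := by
  cases l <;> rfl

theorem map_fst_faceTail (m w i : ℕ) (l : Circle) :
    (faceTail m w i l).map Prod.fst = List.range' (m + 2) i ++ l.map Prod.fst := by
  induction i generalizing l with
  | zero => rfl
  | succ i ih =>
    rw [faceTail, ih, List.range'_concat, List.append_assoc]
    congr 2
    simp only [List.map_cons, List.singleton_append, Nat.add_eq, one_mul]
    congr 1
    omega

end PatchSearch

end Nodes

/-! ### Orbits of the face map -/

section Soundness

open Equiv Equiv.Perm PatchSearch

variable {D : Type*}

namespace Hypermap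

variable {H : Hypermap D}

theorem faceSize_eq_minimalPeriod [Finite D] (H : Hypermap D) (d : D) :
    H.faceSize d = Function.minimalPeriod H.f d := by
  have hset : (PermOrbit.of H.f d).darts =
      (fun i => H.f^[i] d) '' (Finset.range (Function.minimalPeriod H.f d) : Set ℕ) := by
    ext x
    have hx : x ∈ (PermOrbit.of H.f d).darts ↔ H.f.SameCycle d x :=
      ⟨fun h => (Quotient.eq.1 h : H.f.SameCycle x d).symm, fun h => Quotient.sound h.symm⟩
    rw [hx]
    constructor
    · intro h
      obtain ⟨n, rfl⟩ := h.exists_nat_pow_eq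
      have hpos : 0 < Function.minimalPeriod H.f d :=
        Function.minimalPeriod_pos_of_mem_periodicPts
          (Function.mem_periodicPts.2 ⟨orderOf H.f, orderOf_pos _, by
            rw [Function.IsPeriodicPt, Function.IsFixedPt, iterate_eq_pow, pow_orderOf_eq_one]
            rfl⟩)
      refine ⟨n % Function.minimalPeriod H.f d, by simpa using Nat.mod_lt _ hpos, ?_⟩
      simp only [Function.iterate_mod_minimalPeriod_eq, iterate_eq_pow]
    · rintro ⟨i, -, rfl⟩
      exact ⟨i, by simp only [zpow_natCast, iterate_eq_pow]⟩
  rw [faceSize, hset, Set.InjOn.ncard_image, Set.ncard_coe_finset, Finset.card_range]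
  simpa using Function.iterate_injOn_Iio_minimalPeriod (f := H.f) (x := d)

theorem pow_faceSize [Finite D] (H : Hypermap D) (d : D) : (H.f ^ H.faceSize d) d = d := by
  rw [faceSize_eq_minimalPeriod, ← iterate_eq_pow]
  exact Function.isPeriodicPt_minimalPeriod _ _

theorem pow_injOn_faceSize [Finite D] (H : Hypermap D) (d : D) {i j : ℕ} (hi : i < H.faceSize d)
    (hj : j < H.faceSize d) (h : (H.f ^ i) d = (H.f ^ j) d) : i = j := by
  rw [faceSize_eq_minimalPeriod] at hi hj
  refine Function.iterate_injOn_Iio_minimalPeriod (f := H.f) (x := d) hi hj ?_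
  simpa only [iterate_eq_pow] using h

theorem exists_pow_eq_of_face_eq [Finite D] {x d : D}
    (h : PermOrbit.of H.f x = PermOrbit.of H.f d) : ∃ i < H.faceSize d, (H.f ^ i) d = x := by
  have h' : H.f.SameCycle d x := (Quotient.eq.1 h : H.f.SameCycle x d).symm
  obtain ⟨n, rfl⟩ := h'.exists_nat_pow_eq
  have hpos : 0 < H.faceSize d :=
    (Set.ncard_pos (Set.toFinite _)).2 ⟨d, rfl⟩
  refine ⟨n % H.faceSize d, Nat.mod_lt _ hpos, ?_⟩
  rw [faceSize_eq_minimalPeriod, ← iterate_eq_pow, Function.iterate_mod_minimalPeriod_eq,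
    iterate_eq_pow]

theorem face_pow (H : Hypermap D) (d : D) (i : ℕ) :
    PermOrbit.of H.f ((H.f ^ i) d) = PermOrbit.of H.f d :=
  Quotient.sound (SameCycle.symm ⟨i, by rw [zpow_natCast]⟩)

theorem face_f (H : Hypermap D) (d : D) : PermOrbit.of H.f (H.f d) = PermOrbit.of H.f d :=
  face_pow H d 1

/-- The number of faces of size `k`. -/
noncomputable def numFaces (H : Hypermap D) (k : ℕ) : ℕ := {F : H.Face | F.darts.ncard = k}.ncard

end Hypermap

theorem compSetoid_mono {a a' f : Perm D} (h : ∀ d, a d ≠ d → a' d = a d) {x y : D}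
    (hxy : compSetoid a f x y) : compSetoid a' f x y := by
  refine Quotient.eq.1 (compSetoid.apply_eq_of_invariant
    (φ := fun d => (⟦d⟧ : Quotient (compSetoid a' f))) (fun d => ?_) (fun d => ?_) hxy)
  · by_cases hd : a d = d
    · rw [hd]
    · rw [← h d hd]
      exact Quotient.sound ((compSetoid _ _).symm' (compSetoid_apply_left _ _ _))
  · exact Quotient.sound ((compSetoid _ _).symm' (compSetoid_apply_right _ _ _))

/-! ### Soundness of the search -/

namespace PatchSearch

/-- A state of the search describes a patch of faces of `H`, glued along `a`, whose darts
are `A 0, …, A (m - 1)`. -/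
structure Realizes (H : Hypermap D) (cs : List Circle) (rem : List ℕ) (m : ℕ)
    (gl fl : List (ℕ × ℕ)) (A : ℕ → D) (a : Perm D) : Prop where
  inj : ∀ i < m, ∀ j < m, A i = A j → i = j
  partialGluing : IsPartialGluing a H.e
  glued_mem : ∀ d, a d ≠ d → ∃ i < m, A i = d
  connected : ∀ i < m, compSetoid a H.f (A 0) (A i)
  glued : ∀ p ∈ gl, H.e (A p.1) = A p.2
  face : ∀ p ∈ fl, ∀ t < p.2, H.f (A (p.1 + t)) = A (p.1 + (t + 1) % p.2)
  glued_lt : ∀ p ∈ gl, p.1 < m ∧ p.2 < m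
  face_le : ∀ p ∈ fl, p.1 + p.2 ≤ m
  faces : ∃ Fs : Set H.Face, (∀ d, (∃ i < m, A i = d) ↔ PermOrbit.of H.f d ∈ Fs) ∧
    ∀ k, 3 ≤ k → (Fs ∩ {F | F.darts.ncard = k}).ncard + rem.getD (k - 3) 0 = H.numFaces k
  circle : ∀ l ∈ cs, ∃ b, Arc H a A m b l b
  nodup : (cs.flatten.map Prod.fst).Nodup

section Gluing

variable [DecidableEq D] {a e : Perm D} {X : D}

theorem mul_swap_of_ne_fixed (he : ∀ d, e (e d) = d) (h : IsPartialGluing a e) (hX : a X = X) :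
    ∀ d, a d ≠ d → (a * swap X (e X)) d = a d := by
  intro d hd
  rw [mul_apply, swap_apply_of_ne_of_ne]
  · rintro rfl; exact hd hX
  · rintro rfl; exact hd (h.fixed_apply he hX)

theorem mul_swap_apply_left (he : ∀ d, e (e d) = d) (h : IsPartialGluing a e) (hX : a X = X) :
    (a * swap X (e X)) X = e X := by
  rw [mul_apply, swap_apply_left, h.fixed_apply he hX]

theorem mul_swap_apply_right (hX : a X = X) : (a * swap X (e X)) (e X) = X := by
  rw [mul_apply, swap_apply_right, hX]

theorem mul_swap_fixed {d : D} (hd : a d = d) (h1 : d ≠ X) (h2 : d ≠ e X) :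
    (a * swap X (e X)) d = d := by
  rw [mul_apply, swap_apply_of_ne_of_ne h1 h2, hd]

end Gluing

/-- When `z` is glued, the path of corners that ends at `z` is continued by the arc `l` at the mate
of `z`, and the corners joined in this way belong to one node; the test of their code succeeds. -/
theorem okHead_of_arc [Fintype D] {H : Hypermap D} {P : NodeTable} (hP : P.Admits H)
    {a a' : Perm D} {A : ℕ → D} {m : ℕ} {b z : D} {l : Circle} {c : ℕ}
    (ha : IsPartialGluing a H.e) (ha' : IsPartialGluing a' H.e)
    (h : Arc H a' A m (H.f (a' z)) l b) (hp : H.NodePath a b z c)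
    (haa : ∀ x, a x ≠ x → a' x = a x) (hz : a' z ≠ z) : okHead P c l = true := by
  cases l with
  | nil =>
    have hb : H.f (a' z) = b := h
    rw [(ha' z).resolve_left hz] at hb
    have := hP.nodeCode b
    rw [hp.nodeCode_eq ha hb] at this
    exact this
  | cons s l =>
    exact (h.addHead (by simp) hp haa hz).2.1.incomplete hP ha'

namespace Realizes

variable {H : Hypermap D} {st : List Circle} {rem : List ℕ} {m : ℕ} {gl fl : List (ℕ × ℕ)}
  {A : ℕ → D} {a : Perm D}

theorem rotate {l l' : Circle} (h : Realizes H ((l ++ l') :: st) rem m gl fl A a) :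
    Realizes H ((l' ++ l) :: st) rem m gl fl A a := by
  refine { h with circle := ?_, nodup := ?_ }
  · intro k hk
    rw [List.mem_cons] at hk
    rcases hk with rfl | hk
    · obtain ⟨b, hb⟩ := h.circle _ List.mem_cons_self
      obtain ⟨u, h1, h2⟩ := Arc.append.1 hb
      exact ⟨u, Arc.append.2 ⟨b, h2, h1⟩⟩
    · exact h.circle k (List.mem_cons_of_mem _ hk)
  · refine (List.Perm.nodup_iff (List.Perm.map _ ?_)).1 h.nodup
    rw [List.flatten_cons, List.flatten_cons]
    exact List.perm_append_comm.append_right _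

theorem pop (h : Realizes H ([] :: st) rem m gl fl A a) : Realizes H st rem m gl fl A a :=
  { h with
    circle := fun l hl => h.circle l (List.mem_cons_of_mem _ hl)
    nodup := by simpa using h.nodup }

variable {x cx : ℕ} {l : Circle}

theorem head (h : Realizes H (((x, cx) :: l) :: st) rem m gl fl A a) : x < m ∧ a (A x) = A x := by
  obtain ⟨b, hb⟩ := h.circle _ List.mem_cons_self
  exact ⟨hb.1, hb.2.1.apply_last⟩

/-- Planarity: a side is glued to a side on the same boundary circle or to a new face. -/
theorem exists_split [Finite D] (hpl : H.IsPlanar) (hp : H.IsPlain) (hne : ∀ d, H.e d ≠ d)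
    (h : Realizes H (((x, cx) :: l) :: st) rem m gl fl A a) (hmem : ∃ i < m, A i = H.e (A x)) :
    ∃ B y cy C, l = B ++ (y, cy) :: C ∧ H.e (A x) = A y := by
  obtain ⟨hx, hax⟩ := h.head
  obtain ⟨i, hi, hAi⟩ := hmem
  obtain ⟨b, hb⟩ := h.circle _ List.mem_cons_self
  have hcomp : compSetoid a H.f (A x) (H.e (A x)) := by
    rw [← hAi]
    exact (compSetoid _ _).trans' ((compSetoid _ _).symm' (h.connected x hx)) (h.connected i hi)
  have hs := hpl.sameCycle_of_compSetoid hp h.partialGluing hax (hne _) hcomp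
  obtain ⟨j, hj, hej⟩ := hb.exists_mem (h.partialGluing.fixed_apply hp hax) hs
  rw [List.map_cons, List.mem_cons] at hj
  rcases hj with rfl | hj
  · exact absurd hej (hne _)
  · obtain ⟨⟨y, cy⟩, hy, rfl⟩ := List.mem_map.1 hj
    obtain ⟨B, C, rfl⟩ := List.append_of_mem hy
    exact ⟨B, y, cy, C, rfl, hej⟩

/-- Gluing two sides of a boundary circle splits it into two. -/
theorem glue [Fintype D] [DecidableEq D] {P : NodeTable} (hP : P.Admits H) (hp : H.IsPlain)
    (hne : ∀ d, H.e d ≠ d) {B C : Circle} {y cy : ℕ}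
    (h : Realizes H (((x, cx) :: (B ++ (y, cy) :: C)) :: st) rem m gl fl A a)
    (hxy : H.e (A x) = A y) :
    okHead P cx C = true ∧ okHead P cy B = true ∧
    Realizes H (addHead cx C :: addHead cy B :: st) rem m ((x, y) :: gl) fl A
      (a * swap (A x) (H.e (A x))) := by
  obtain ⟨hx, hax⟩ := h.head
  set a' := a * swap (A x) (H.e (A x)) with ha'
  have ha := h.partialGluing
  have haa := mul_swap_of_ne_fixed hp ha hax
  have hpart : IsPartialGluing a' H.e := ha.mul_swap hp hax
  have hX : a' (A x) = A y := by rw [ha', mul_swap_apply_left hp ha hax, hxy]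
  have hY : a' (A y) = A x := by rw [← hxy, ha', mul_swap_apply_right hax]
  have hXY : A y ≠ A x := hxy ▸ hne _
  obtain ⟨b, hb⟩ := h.circle _ List.mem_cons_self
  obtain ⟨-, hpx, hrest⟩ := hb
  obtain ⟨u, hB, hy, hpy, hC⟩ := Arc.append.1 hrest
  have hfix : ∀ l' : Circle, ∀ v w, Arc H a A m v l' w → x ∉ l'.map Prod.fst →
      y ∉ l'.map Prod.fst → Arc H a' A m v l' w := by
    intro l' v w hl' h1 h2
    refine hl'.mono le_rfl (fun _ _ => rfl) haa fun i hi => ?_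
    refine mul_swap_fixed (hl'.fixed i hi) (fun hc => h1 ?_) (fun hc => h2 ?_)
    · rwa [← h.inj i (hl'.lt i hi) x hx hc]
    · rw [hxy] at hc
      rwa [← h.inj i (hl'.lt i hi) y hy hc]
  have hnd := h.nodup
  simp only [List.flatten_cons, List.map_append, List.map_cons, List.cons_append,
    List.append_assoc] at hnd
  rw [List.nodup_cons] at hnd
  obtain ⟨hxn, hnd⟩ := hnd
  have hnd' : (y :: (C.map Prod.fst ++ (B.map Prod.fst ++ st.flatten.map Prod.fst))).Nodup := by
    refine (List.Perm.nodup_iff ?_).1 hnd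
    refine List.perm_middle.trans (List.Perm.cons _ ?_)
    rw [← List.append_assoc, ← List.append_assoc]
    exact List.perm_append_comm.append_right _
  rw [List.nodup_cons] at hnd'
  obtain ⟨hyn, hnd'⟩ := hnd'
  simp only [List.mem_append, List.mem_cons, not_or] at hxn hyn
  have hC' : Arc H a' A m (H.f (a' (A x))) C b := by
    rw [hX]; exact hfix _ _ _ hC hxn.2.2.1 hyn.1
  have hB' : Arc H a' A m (H.f (a' (A y))) B u := by
    rw [hY]; exact hfix _ _ _ hB hxn.1 hyn.2.1
  have hX' : a' (A x) ≠ A x := by rw [hX]; exact hXY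
  have hY' : a' (A y) ≠ A y := by rw [hY]; exact hXY.symm
  refine ⟨okHead_of_arc hP ha hpart hC' hpx haa hX', okHead_of_arc hP ha hpart hB' hpy haa hY', ?_⟩
  refine { h with
    partialGluing := hpart
    glued_mem := ?_
    connected := fun i hi => compSetoid_mono haa (h.connected i hi)
    glued := ?_
    glued_lt := ?_
    circle := ?_
    nodup := ?_ }
  · intro d hd
    by_cases h1 : d = A x
    · exact ⟨x, hx, h1.symm⟩
    by_cases h2 : d = A y
    · exact ⟨y, hy, h2.symm⟩
    refine h.glued_mem d fun hd' => hd ?_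
    exact mul_swap_fixed hd' h1 (hxy ▸ h2)
  · intro p hp'
    rw [List.mem_cons] at hp'
    rcases hp' with rfl | hp'
    · exact hxy
    · exact h.glued p hp'
  · intro p hp'
    rw [List.mem_cons] at hp'
    rcases hp' with rfl | hp'
    · exact ⟨hx, hy⟩
    · exact h.glued_lt p hp'
  · intro k hk
    rw [List.mem_cons, List.mem_cons] at hk
    rcases hk with rfl | rfl | hk
    · by_cases hnil : C = []
      · subst hnil; exact ⟨b, rfl⟩
      · exact ⟨b, hC'.addHead hnil hpx haa hX'⟩
    · by_cases hnil : B = []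
      · subst hnil; exact ⟨u, rfl⟩
      · exact ⟨u, hB'.addHead hnil hpy haa hY'⟩
    · obtain ⟨v, hv⟩ := h.circle k (List.mem_cons_of_mem _ hk)
      refine ⟨v, hfix _ _ _ hv (fun hxk => hxn.2.2.2 ?_) (fun hyk => hyn.2.2 ?_)⟩
      · exact List.map_subset _ (fun s hs => List.mem_flatten_of_mem hk hs) hxk
      · exact List.map_subset _ (fun s hs => List.mem_flatten_of_mem hk hs) hyk
  · simpa [map_fst_addHead] using hnd'

/-- Gluing a face that is not in the patch replaces the side `x` by the other sides of the face. -/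
theorem addFace [Fintype D] [DecidableEq D] {P : NodeTable} (hP : P.Admits H) (hp : H.IsPlain)
    {k : ℕ} (h : Realizes H (((x, cx) :: l) :: st) rem m gl fl A a) (hl : l ≠ [])
    (hmem : ¬ ∃ i < m, A i = H.e (A x)) (hk : H.faceSize (H.e (A x)) = k) (hk3 : 3 ≤ k) :
    rem.getD (k - 3) 0 ≠ 0 ∧ bit P.incomplete (cx + sizeCode k) = true ∧
    okHead P (sizeCode k) l = true ∧
    ∃ A', Realizes H
      (((m + 1, cx + sizeCode k) :: faceTail m (sizeCode k) (k - 2) (addHead (sizeCode k) l)) :: st)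
      (rem.set (k - 3) (rem.getD (k - 3) 0 - 1)) (m + k) ((x, m) :: gl) ((m, k) :: fl) A'
      (a * swap (A x) (H.e (A x))) := by
  obtain ⟨hx, hax⟩ := h.head
  set Y := H.e (A x) with hYdef
  set a' := a * swap (A x) Y with ha'
  have ha := h.partialGluing
  have haa : ∀ d, a d ≠ d → a' d = a d := mul_swap_of_ne_fixed hp ha hax
  have hpart : IsPartialGluing a' H.e := ha.mul_swap hp hax
  have hX : a' (A x) = Y := mul_swap_apply_left hp ha hax
  have hY : a' Y = A x := mul_swap_apply_right hax
  have hXY : Y ≠ A x := fun hc => hmem ⟨x, hx, hc.symm⟩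
  have hout : ∀ d, (¬ ∃ i < m, A i = d) → a d = d := fun d hd => by
    by_contra hc
    exact hd (h.glued_mem d hc)
  have haY : a Y = Y := hout Y hmem
  obtain ⟨Fs, hFs, hcount⟩ := h.faces
  set F := PermOrbit.of H.f Y with hF
  have hFn : F ∉ Fs := fun hc => hmem ((hFs Y).2 hc)
  have hsize : F.darts.ncard = k := hk
  -- the darts of the new face are numbered from `m` on
  let A' : ℕ → D := fun i => if i < m then A i else (H.f ^ (i - m)) Y
  have hA : ∀ i < m, A' i = A i := fun i hi => if_pos hi
  have hA' : ∀ j, A' (m + j) = (H.f ^ j) Y := fun j => by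
    simp only [A', if_neg (show ¬ m + j < m by omega), Nat.add_sub_cancel_left]
  have hface : ∀ j, PermOrbit.of H.f (A' (m + j)) = F := fun j => by
    rw [hA', Hypermap.face_pow]
  have hnew : ∀ j, ¬ ∃ i < m, A i = A' (m + j) := fun j hc => by
    rw [hFs, hface] at hc
    exact hFn hc
  have hfix : ∀ j, 0 < j → j < k → a' (A' (m + j)) = A' (m + j) := fun j hj hjk => by
    refine mul_swap_fixed (hout _ (hnew j)) (fun hc => hnew j ⟨x, hx, hc.symm⟩) fun hc => ?_
    rw [hA'] at hc
    exact hj.ne' (Hypermap.pow_injOn_faceSize H Y (hk ▸ hjk) (hk ▸ (by omega)) hc)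
  have hcode : ∀ j, H.cornerCode (A' (m + j)) = sizeCode k := fun j => by
    rw [Hypermap.cornerCode, Hypermap.faceSize, hface, hsize]
  have hnext : ∀ j, H.f (A' (m + j)) = A' (m + j + 1) := fun j => by
    rw [add_assoc, hA', hA', pow_succ', mul_apply]
  have hcodeY : H.cornerCode Y = sizeCode k := by rw [Hypermap.cornerCode, hk]
  have hlast : H.f (A' (m + (k - 2) + 1)) = Y := by
    rw [add_assoc, hnext, add_assoc, hA', show k - 2 + 1 + 1 = k by omega, ← hk]
    exact Hypermap.pow_faceSize H Y
  obtain ⟨b, hb⟩ := h.circle _ List.mem_cons_self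
  obtain ⟨-, hpx, hrest⟩ := hb
  have hnd := h.nodup
  simp only [List.flatten_cons, List.map_append, List.map_cons, List.cons_append,
    List.nodup_cons] at hnd
  obtain ⟨hxn, hnd⟩ := hnd
  have hold : ∀ l' : Circle, ∀ v w, Arc H a A m v l' w → x ∉ l'.map Prod.fst →
      Arc H a' A' (m + k) v l' w := by
    intro l' v w hl' h1
    refine hl'.mono (by omega) hA haa fun i hi => ?_
    refine mul_swap_fixed (hl'.fixed i hi) (fun hc => h1 ?_) (fun hc => ?_)
    · rwa [← h.inj i (hl'.lt i hi) x hx hc]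
    · exact hmem ⟨i, hl'.lt i hi, hc⟩
  have hY' : a' Y ≠ Y := by rw [hY]; exact hXY.symm
  have hpY : H.NodePath a Y Y (sizeCode k) := hcodeY ▸ .last haY
  have harc : Arc H a' A' (m + k) (H.f (a' Y)) l b := by
    rw [hY]
    exact hold _ _ _ hrest fun hc => hxn (List.mem_append_left _ hc)
  have harc' := harc.addHead hl hpY haa hY'
  have hp1 : H.NodePath a' b (A' (m + 1)) (cx + sizeCode k) := by
    rw [add_comm cx, ← hcode 1]
    refine hpx.trans haa (by rw [hX]; exact hXY) ?_
    have : H.f (a' (A x)) = A' (m + 1) := by rw [hX, hA', pow_one]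
    rw [this]
    exact .last (hfix 1 (by omega) (by omega))
  have hrem : rem.getD (k - 3) 0 ≠ 0 := by
    intro hc
    have h1 := hcount k hk3
    rw [hc, add_zero, Hypermap.numFaces] at h1
    have h2 : Fs ∩ {F | F.darts.ncard = k} = {F | F.darts.ncard = k} :=
      Set.eq_of_subset_of_ncard_le Set.inter_subset_right h1.ge (Set.toFinite _)
    exact hFn (Set.inter_eq_right.1 h2 hsize)
  have hklen : k - 3 < rem.length := by
    by_contra hc
    exact hrem (List.getD_eq_default _ _ (by omega))
  refine ⟨hrem, hp1.incomplete hP hpart,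
    (match l, hl, harc' with
      | _ :: _, _, h => h.2.1.incomplete hP hpart), A', ?_⟩
  have hsplit : ∀ i < m + k, i < m ∨ ∃ j < k, i = m + j := fun i hi => by
    by_cases him : i < m
    · exact Or.inl him
    · exact Or.inr ⟨i - m, by omega, by omega⟩
  refine
    { inj := ?_
      partialGluing := hpart
      glued_mem := ?_
      connected := ?_
      glued := ?_
      face := ?_
      glued_lt := ?_
      face_le := ?_
      faces := ?_
      circle := ?_
      nodup := ?_ }
  · intro i hi j hj hij
    rcases hsplit i hi with hi | ⟨i, hi', rfl⟩ <;> rcases hsplit j hj with hj | ⟨j, hj', rfl⟩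
    · rw [hA i hi, hA j hj] at hij
      exact h.inj i hi j hj hij
    · rw [hA i hi] at hij
      exact absurd ⟨i, hi, hij⟩ (hnew j)
    · rw [hA j hj] at hij
      exact absurd ⟨j, hj, hij.symm⟩ (hnew i)
    · rw [hA', hA'] at hij
      rw [Hypermap.pow_injOn_faceSize H Y (hk ▸ hi') (hk ▸ hj') hij]
  · intro d hd
    by_cases h1 : d = A x
    · exact ⟨x, by omega, by rw [hA x hx, h1]⟩
    by_cases h2 : d = Y
    · exact ⟨m + 0, by omega, by rw [hA', h2]; rfl⟩
    obtain ⟨i, hi, rfl⟩ := h.glued_mem d fun hd' => hd (mul_swap_fixed hd' h1 h2)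
    exact ⟨i, by omega, hA i hi⟩
  · have h0 : A' 0 = A 0 := hA 0 (by omega)
    rw [h0]
    have hY0 : compSetoid a' H.f (A 0) Y := by
      refine (compSetoid _ _).trans' (compSetoid_mono haa (h.connected x hx)) ?_
      rw [← hX]
      exact compSetoid_apply_left _ _ _
    intro i hi
    rcases hsplit i hi with hi | ⟨j, -, rfl⟩
    · rw [hA i hi]
      exact compSetoid_mono haa (h.connected i hi)
    · induction j with
      | zero => rw [hA']; exact hY0
      | succ j ih =>
        rw [← add_assoc, ← hnext]
        exact (compSetoid _ _).trans' (ih (by omega)) (compSetoid_apply_right _ _ _)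
  · intro p hp'
    rw [List.mem_cons] at hp'
    rcases hp' with rfl | hp'
    · have : A' m = Y := hA' 0
      simp only [this, hA x hx]
      rfl
    · obtain ⟨h1, h2⟩ := h.glued_lt p hp'
      rw [hA _ h1, hA _ h2]
      exact h.glued p hp'
  · intro p hp' t ht
    rw [List.mem_cons] at hp'
    rcases hp' with rfl | hp'
    · simp only at ht ⊢
      rw [hnext]
      rcases Nat.lt_or_eq_of_le (show t + 1 ≤ k from ht) with h1 | h1
      · rw [Nat.mod_eq_of_lt h1]
        rfl
      · rw [h1, Nat.mod_self, add_assoc, hA', hA', h1, ← hk]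
        exact Hypermap.pow_faceSize H Y
    · have h1 := h.face_le p hp'
      have h2 : (t + 1) % p.2 < p.2 := Nat.mod_lt _ (by omega)
      rw [hA _ (by omega), hA _ (by omega)]
      exact h.face p hp' t ht
  · intro p hp'
    rw [List.mem_cons] at hp'
    rcases hp' with rfl | hp'
    · exact ⟨by simp only; omega, by simp only; omega⟩
    · have := h.glued_lt p hp'
      omega
  · intro p hp'
    rw [List.mem_cons] at hp'
    rcases hp' with rfl | hp'
    · exact le_rfl
    · have := h.face_le p hp'
      omega
  · refine ⟨insert F Fs, fun d => ?_, fun k' hk' => ?_⟩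
    · rw [Set.mem_insert_iff]
      constructor
      · rintro ⟨i, hi, rfl⟩
        rcases hsplit i hi with hi | ⟨j, -, rfl⟩
        · rw [hA i hi]
          exact Or.inr ((hFs _).1 ⟨i, hi, rfl⟩)
        · exact Or.inl (hface j)
      · rintro (hd | hd)
        · obtain ⟨j, hj, rfl⟩ := Hypermap.exists_pow_eq_of_face_eq hd
          exact ⟨m + j, by omega, hA' j⟩
        · obtain ⟨i, hi, rfl⟩ := (hFs d).2 hd
          exact ⟨i, by omega, hA i hi⟩
    · by_cases hkk : k' = k
      · subst hkk
        rw [Set.insert_inter_of_mem (show F ∈ {F : H.Face | F.darts.ncard = k'} from hsize),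
          Set.ncard_insert_of_notMem (fun hc => hFn hc.1) (Set.toFinite _), ← hcount k' hk']
        have : (rem.set (k' - 3) (rem.getD (k' - 3) 0 - 1)).getD (k' - 3) 0
            = rem.getD (k' - 3) 0 - 1 := by
          rw [List.getD_eq_getElem?_getD, List.getElem?_set_self hklen]
          rfl
        rw [this]
        omega
      · rw [Set.insert_inter_of_notMem (show F ∉ {F : H.Face | F.darts.ncard = k'} from
          fun hc => hkk (hc.symm.trans hsize)), ← hcount k' hk']
        congr 1
        rw [List.getD_eq_getElem?_getD, List.getElem?_set_ne (by omega),
          ← List.getD_eq_getElem?_getD]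
  · intro l' hl'
    rw [List.mem_cons] at hl'
    rcases hl' with rfl | hl'
    · refine ⟨b, by simp only; omega, hp1, ?_⟩
      refine Arc.faceTail (k - 2) (by omega) (fun j _ => hnext (j + 1))
        (fun j hj => hfix (j + 2) (by omega) (by omega)) (fun j _ => hcode (j + 2)) ?_
      rw [hlast]
      exact harc'
    · obtain ⟨v, hv⟩ := h.circle l' (List.mem_cons_of_mem _ hl')
      refine ⟨v, hold _ _ _ hv fun hc => hxn (List.mem_append_right _ ?_)⟩
      exact List.map_subset _ (fun s hs => List.mem_flatten_of_mem hl' hs) hc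
  · have hlt : ∀ i ∈ (l ++ st.flatten).map Prod.fst, i < m := by
      intro i hi
      rw [List.map_append, List.mem_append] at hi
      rcases hi with hi | hi
      · exact hrest.lt i hi
      · obtain ⟨s, hs, rfl⟩ := List.mem_map.1 hi
        obtain ⟨l', hl', hsl⟩ := List.mem_flatten.1 hs
        obtain ⟨v, hv⟩ := h.circle l' (List.mem_cons_of_mem _ hl')
        exact hv.lt _ (List.mem_map_of_mem hsl)
    have hlist : ((((m + 1, cx + sizeCode k) :: faceTail m (sizeCode k) (k - 2)
        (addHead (sizeCode k) l)) :: st).flatten.map Prod.fst) =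
        List.range' (m + 1) (k - 1) ++ (l ++ st.flatten).map Prod.fst := by
      rw [show k - 1 = (k - 2) + 1 by omega, List.range'_succ]
      simp [map_fst_faceTail, map_fst_addHead]
    rw [hlist, List.nodup_append']
    refine ⟨List.nodup_range' , by simpa using hnd, fun i hi hi' => ?_⟩
    have := hlt i hi'
    rw [List.mem_range'] at hi
    omega

end Realizes

/-- The facts about planar hypermaps that the search relies on. -/
structure IsSearchable (H : Hypermap D) : Prop where
  planar : H.IsPlanar
  plain : H.IsPlain
  nondegenerate : ∀ d, H.e d ≠ d
  no_loops : ∀ d, ¬ (H.f * H.e).SameCycle d (H.e d)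
  faceSize : ∀ d, 3 ≤ H.faceSize d ∧ H.faceSize d ≤ 8

variable {H : Hypermap D} {P : NodeTable} {leaf : ℕ → List (ℕ × ℕ) → List (ℕ × ℕ) → Bool}

/-- A boundary circle with a single side would be a loop. -/
theorem Realizes.ne_singleton {st : List Circle} {rem : List ℕ} {m : ℕ} {gl fl : List (ℕ × ℕ)}
    {A : ℕ → D} {a : Perm D} {x cx : ℕ} (hH : IsSearchable H) :
    ¬ Realizes H ([(x, cx)] :: st) rem m gl fl A a := by
  intro h
  obtain ⟨b, -, hp, hb⟩ := h.circle _ List.mem_cons_self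
  have hb : H.f (A x) = b := hb
  have h1 : (H.f * H.e).SameCycle (H.e (A x)) b :=
    ⟨1, by rw [zpow_one, mul_apply, hH.plain, hb]⟩
  exact hH.no_loops _ (h1.trans (hp.sameCycle h.partialGluing)).symm

theorem of_addFace_eq_true {ih : StatePred} {st : List Circle} {rem : List ℕ} {m : ℕ}
    {gl fl : List (ℕ × ℕ)} {x cx : ℕ} {l : Circle} {k : ℕ}
    (h : addFace P ih st rem m gl fl x cx l k = true) (h1 : rem.getD (k - 3) 0 ≠ 0)
    (h2 : bit P.incomplete (cx + sizeCode k) = true) (h3 : okHead P (sizeCode k) l = true) :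
    ih (((m + 1, cx + sizeCode k) :: faceTail m (sizeCode k) (k - 2) (addHead (sizeCode k) l)) ::
      st) (rem.set (k - 3) (rem.getD (k - 3) 0 - 1)) (m + k) ((x, m) :: gl) ((m, k) :: fl)
      = true := by
  have h0 : Nat.blt 0 (rem.getD (k - 3) 0) = true := Nat.ble_eq_true_of_le (Nat.pos_of_ne_zero h1)
  simp only [addFace, force_eq, Nat.sub_eq, Nat.add_eq] at h
  exact of_implies (of_implies (of_implies h h0) h2) h3

/-- A step of the search leads from a state with a boundary circle that describes a patch of `H` to
another one, which does not depend on the continuation `ih`. -/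
theorem step_sound [Fintype D] (hH : IsSearchable H) (hP : P.Admits H) {cyc : Circle}
    {st : List Circle} {rem : List ℕ} {m : ℕ} {gl fl : List (ℕ × ℕ)} {A : ℕ → D} {a : Perm D}
    (hr : Realizes H (cyc :: st) rem m gl fl A a) :
    ∃ cs' rem' m' gl' fl' A' a', Realizes H cs' rem' m' gl' fl' A' a' ∧
      ∀ ih, step P leaf ih (cyc :: st) rem m gl fl = true → ih cs' rem' m' gl' fl' = true := by
  classical
  have hr' : Realizes H (List.append (cyc.drop (maxPos 0 0 0 cyc))
      (cyc.take (maxPos 0 0 0 cyc)) :: st) rem m gl fl A a :=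
    Realizes.rotate (by rw [List.take_append_drop]; exact hr)
  simp only [step]
  generalize List.append (cyc.drop (maxPos 0 0 0 cyc)) (cyc.take (maxPos 0 0 0 cyc)) = c at hr'
  match c, hr' with
  | [], hr' => exact ⟨_, _, _, _, _, _, _, hr'.pop, fun _ hs => hs⟩
  | [(x, cx)], hr' => exact absurd hr' (Realizes.ne_singleton hH)
  | (x, cx) :: s :: l, hr' =>
    by_cases hmem : ∃ i < m, A i = H.e (A x)
    · obtain ⟨B, y, cy, C, hl, hxy⟩ :=
        hr'.exists_split hH.planar hH.plain hH.nondegenerate hmem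
      rw [hl] at hr'
      obtain ⟨hC, hB, hr''⟩ := hr'.glue hP hH.plain hH.nondegenerate hxy
      exact ⟨_, _, _, _, _, _, _, hr'', fun ih hs =>
        glueAll_spec (ih := fun s g => ih s rem m g fl) (both_eq_true hs).1 hl hC hB⟩
    · have hsz := hH.faceSize (H.e (A x))
      obtain ⟨hrem, hb, hok, A', hr''⟩ :=
        hr'.addFace hP hH.plain (by simp) hmem rfl hsz.1
      refine ⟨_, _, _, _, _, _, _, hr'', fun ih hs => ?_⟩
      have hadd : addFace P ih st rem m gl fl x cx (s :: l) (H.faceSize (H.e (A x))) = true := by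
        obtain ⟨-, hs⟩ := both_eq_true hs
        obtain ⟨h3, hs⟩ := both_eq_true hs
        obtain ⟨h4, hs⟩ := both_eq_true hs
        obtain ⟨h5, hs⟩ := both_eq_true hs
        obtain ⟨h6, hs⟩ := both_eq_true hs
        obtain ⟨h7, h8⟩ := both_eq_true hs
        obtain ⟨h1, h2⟩ := hsz
        generalize H.faceSize (H.e (A x)) = k at h1 h2
        interval_cases k <;> assumption
      exact of_addFace_eq_true hadd hrem hb hok

/-- A state of the search that describes a patch of `H` leads to a complete state that describes
`H`, or after `n` steps to another state that describes a patch of `H`. -/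
theorem searchThen_sound [Fintype D] (hH : IsSearchable H) (hP : P.Admits H) :
    ∀ (n : ℕ) {cs : List Circle} {rem : List ℕ} {m : ℕ} {gl fl : List (ℕ × ℕ)} {A : ℕ → D}
      {a : Perm D}, Realizes H cs rem m gl fl A a → ∃ cs' rem' m' gl' fl' A' a',
      Realizes H cs' rem' m' gl' fl' A' a' ∧
      ((cs' = [] ∧ ∀ base, searchThen P leaf base n cs rem m gl fl = true →
        leaf m' gl' fl' = true) ∨
      ∀ base, searchThen P leaf base n cs rem m gl fl = true →
        base cs' rem' m' gl' fl' = true) := by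
  intro n
  induction n with
  | zero => exact fun hr => ⟨_, _, _, _, _, _, _, hr, Or.inr fun _ h => h⟩
  | succ n ih =>
    intro cs rem m gl fl A a hr
    cases cs with
    | nil => exact ⟨_, _, _, _, _, _, _, hr, Or.inl ⟨rfl, fun _ h => h⟩⟩
    | cons cyc st =>
      obtain ⟨cs1, rem1, m1, gl1, fl1, A1, a1, hr1, h1⟩ := step_sound (leaf := leaf) hH hP hr
      obtain ⟨cs2, rem2, m2, gl2, fl2, A2, a2, hr2, h2⟩ := ih hr1
      exact ⟨cs2, rem2, m2, gl2, fl2, A2, a2, hr2,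
        h2.imp (And.imp_right fun h base hs => h base (h1 _ hs)) fun h base hs => h base (h1 _ hs)⟩

/-- If all parts of the search succeed that starts with a face whose size is the size of some face
of `H`, then one of them reaches a complete state that describes `H`. -/
theorem searchFrom_sound [Fintype D] (hH : IsSearchable H) (hP : P.Admits H) {faces : List ℕ}
    (hfaces : ∀ k, 3 ≤ k → faces.getD (k - 3) 0 = H.numFaces k) (d : D) {M : ℕ} (hM : 0 < M)
    (h : ∀ i < M, searchFrom P leaf (H.faceSize d) faces M i = true) :
    ∃ rem m gl fl A a, leaf m gl fl = true ∧ Realizes H [] rem m gl fl A a := by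
  set k := H.faceSize d with hk
  suffices hr : Realizes H
      [(0, sizeCode k) :: (1, sizeCode k) :: faceTail 0 (sizeCode k) (k - 2) []]
      (faces.set (k - 3) (faces.getD (k - 3) 0 - 1)) k [] [(0, k)] (fun i => (H.f ^ i) d) 1 by
    obtain ⟨cs, rem, m, gl, fl, A, a, hr1, ⟨rfl, h1⟩ | h1⟩ :=
      searchThen_sound (leaf := leaf) hH hP 7 hr
    · exact ⟨_, _, _, _, _, _, h1 _ (h 0 hM), hr1⟩
    · have h2 := of_implies (h1 _ (h ((gl.map Prod.snd).sum % M) (Nat.mod_lt _ hM)))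
        (Nat.beq_refl _)
      obtain ⟨cs', rem', m', gl', fl', A', a', hr2, ⟨rfl, h3⟩ | h3⟩ :=
        searchThen_sound (leaf := leaf) hH hP 80 hr1
      · exact ⟨_, _, _, _, _, _, h3 _ h2, hr2⟩
      · exact absurd (h3 _ h2) (by simp)
  have hk3 : 3 ≤ k := (hH.faceSize d).1
  have hcode : ∀ i, H.cornerCode ((H.f ^ i) d) = sizeCode k := fun i => by
    rw [Hypermap.cornerCode, Hypermap.faceSize, Hypermap.face_pow]
    rfl
  have hnext : ∀ i, H.f ((H.f ^ i) d) = (H.f ^ (i + 1)) d := fun i => by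
    rw [pow_succ', mul_apply]
  have hpath : ∀ i, H.NodePath 1 ((H.f ^ i) d) ((H.f ^ i) d) (sizeCode k) := fun i =>
    hcode i ▸ .last rfl
  have hper := Hypermap.pow_faceSize H d
  refine
    { inj := fun i hi j hj hij => Hypermap.pow_injOn_faceSize H d hi hj hij
      partialGluing := fun _ => Or.inl rfl
      glued_mem := fun d hd => absurd rfl hd
      connected := ?_
      glued := by simp
      face := ?_
      glued_lt := by simp
      face_le := by simp
      faces := ⟨{PermOrbit.of H.f d}, fun x => ?_, fun k' hk' => ?_⟩
      circle := ?_
      nodup := ?_ }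
  · intro i _
    induction i with
    | zero => exact (compSetoid _ _).refl' _
    | succ i ih =>
      rw [← hnext]
      exact (compSetoid _ _).trans' (ih (by omega)) (compSetoid_apply_right _ _ _)
  · intro p hp t ht
    rw [List.mem_singleton] at hp
    subst hp
    simp only [zero_add] at ht ⊢
    rw [hnext]
    rcases Nat.lt_or_eq_of_le (show t + 1 ≤ k from ht) with h1 | h1
    · rw [Nat.mod_eq_of_lt h1]
    · rw [h1, Nat.mod_self, hper]
      rfl
  · rw [Set.mem_singleton_iff]
    constructor
    · rintro ⟨i, -, rfl⟩
      exact Hypermap.face_pow H d i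
    · exact fun hx => Hypermap.exists_pow_eq_of_face_eq hx
  · have hlen : k - 3 < faces.length := by
      by_contra hc
      have h1 := hfaces k hk3
      rw [List.getD_eq_default _ _ (by omega), Hypermap.numFaces] at h1
      have h2 := (Set.ncard_eq_zero (Set.toFinite _)).1 h1.symm
      exact Set.eq_empty_iff_forall_notMem.1 h2 (PermOrbit.of H.f d) rfl
    rw [← hfaces k' hk']
    by_cases hkk : k' = k
    · subst hkk
      have h1 : ({PermOrbit.of H.f d} ∩ {F : H.Face | F.darts.ncard = k}) =
          {PermOrbit.of H.f d} := Set.inter_eq_left.2 (Set.singleton_subset_iff.2 hk.symm)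
      have h2 : (faces.set (k - 3) (faces.getD (k - 3) 0 - 1)).getD (k - 3) 0
          = faces.getD (k - 3) 0 - 1 := by
        rw [List.getD_eq_getElem?_getD, List.getElem?_set_self hlen]
        rfl
      have h3 : faces.getD (k - 3) 0 ≠ 0 := by
        rw [hfaces k hk3, Hypermap.numFaces]
        refine ((Set.ncard_pos (Set.toFinite _)).2 ⟨PermOrbit.of H.f d, hk.symm⟩).ne'
      rw [h1, h2, Set.ncard_singleton]
      omega
    · have h1 : ({PermOrbit.of H.f d} ∩ {F : H.Face | F.darts.ncard = k'}) = ∅ :=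
        Set.singleton_inter_eq_empty.2 fun hc => hkk (hc.symm.trans hk.symm)
      rw [h1, Set.ncard_empty, zero_add, List.getD_eq_getElem?_getD,
        List.getElem?_set_ne (by omega), ← List.getD_eq_getElem?_getD]
  · intro l hl
    rw [List.mem_singleton] at hl
    subst hl
    refine ⟨d, by simp only; omega, hpath 0, by simp only; omega, ?_, ?_⟩
    · rw [hnext]
      exact hpath 1
    · refine Arc.faceTail (k - 2) (by omega) (fun j _ => hnext _) (fun j _ => rfl)
        (fun j _ => hcode _) ?_
      change H.f ((H.f ^ (0 + (k - 2) + 1)) d) = d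
      rw [hnext, show 0 + (k - 2) + 1 + 1 = k by omega, hper]
  · have : ([(0, sizeCode k) :: (1, sizeCode k) :: faceTail 0 (sizeCode k) (k - 2) []] :
        List Circle).flatten.map Prod.fst = List.range' 0 k := by
      rw [show k = (k - 2) + 1 + 1 by omega, List.range'_succ, List.range'_succ]
      simp [map_fst_faceTail]
    rw [this]
    exact List.nodup_range'

end PatchSearch

end Soundness

/-! ### Comparing a complete patch with a given hypermap -/

section Compare

open Equiv Equiv.Perm

namespace PatchSearch

/-- The `i`-th digit of `T` in base `64`; a number serves as a table with entries below `64`. -/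
def digit (T i : ℕ) : ℕ := Nat.land (Nat.shiftRight T (Nat.mul 6 i)) 63

/-- The face and the edge map of `H` are given by tables on a numbering of the darts. -/
def IsTabulated {D : Type*} (H : Hypermap D) (n E F : ℕ) : Prop :=
  ∃ g : D ≃ Fin n, ∀ d, (g (H.e d)).val = digit E (g d) ∧ (g (H.f d)).val = digit F (g d)

theorem IsTabulated.isIsomorphic {D D' : Type*} {H : Hypermap D} {H' : Hypermap D'} {n E F : ℕ}
    (h : IsTabulated H n E F) (h' : IsTabulated H' n E F) : H.IsIsomorphic H' := by
  obtain ⟨g, hg⟩ := h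
  obtain ⟨g', hg'⟩ := h'
  have he : ∀ x, (g.trans g'.symm) (H.e x) = H'.e ((g.trans g'.symm) x) := fun x => by
    rw [← g'.injective.eq_iff, Fin.ext_iff, (hg' _).1]
    simp [(hg x).1]
  have hf : ∀ x, (g.trans g'.symm) (H.f x) = H'.f ((g.trans g'.symm) x) := fun x => by
    rw [← g'.injective.eq_iff, Fin.ext_iff, (hg' _).2]
    simp [(hg x).2]
  refine ⟨g.trans g'.symm, he, fun x => ?_, hf⟩
  -- the node map is determined by the edge and the face map
  apply (H'.f * H'.e).injective
  have h1 : ∀ {D : Type _} (H : Hypermap D) (y : D), (H.f * H.e) (H.n y) = y := fun H y => by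
    rw [Hypermap.n_eq]
    exact Equiv.apply_symm_apply _ _
  rw [h1, mul_apply, ← he, ← hf]
  congr 1
  have h2 : (H.f * H.e) (H.n x) = x := by
    rw [Hypermap.n_eq]
    exact Equiv.apply_symm_apply _ _
  exact h2

/-- Every dart of a patch with `m` darts is glued, and lies in a face of the list `fl`. -/
def isComplete (m : ℕ) (gl fl : List (ℕ × ℕ)) : Bool :=
  and (Nat.ble 1 m) ((List.range m).all fun i =>
    and (gl.any fun p => or (Nat.beq i p.1) (Nat.beq i p.2))
      (fl.any fun p => and (Nat.ble p.1 i) (Nat.blt i (Nat.add p.1 p.2))))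

/-- Put the orbit of `a` under the map with table `F` into the entries of the table `φ` that begin
with the entry `s`, and apply `k` to the result; the orbit must have `n` elements. -/
def putOrbit (F : ℕ) (k : ℕ → Bool) (b : ℕ) : ℕ → ℕ → ℕ → ℕ → Bool
  | 0, a, _, φ => and (Nat.beq a b) (k φ)
  | n + 1, a, s, φ => force (digit F a) fun a' =>
      force (Nat.add φ (Nat.shiftLeft a (Nat.mul 6 s))) fun φ' => putOrbit F k b n a' (s + 1) φ'

/-- Extend the table `φ` of a map from a patch to a tabulated hypermap along the pairs of glued
darts, in the order in which they were glued, and apply `k` to the result. -/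
def extendMap (E F : ℕ) (k : ℕ → Bool) : List (ℕ × ℕ) → List (ℕ × ℕ) → ℕ → Bool
  | [], _, φ => k φ
  | (x, y) :: gl, [], φ => and (Nat.beq (digit E (digit φ x)) (digit φ y)) (extendMap E F k gl [] φ)
  | (x, y) :: gl, (s, n) :: fl, φ =>
    cond (Nat.beq y s)
      (force (digit E (digit φ x)) fun a =>
        putOrbit F (fun φ' => extendMap E F k gl fl φ') a n a s φ)
      (and (Nat.beq (digit E (digit φ x)) (digit φ y)) (extendMap E F k gl ((s, n) :: fl) φ))

/-- The table `φ` describes an isomorphism from a complete patch with `m` darts to a tabulated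
hypermap. -/
def isIso (E F m : ℕ) (gl fl : List (ℕ × ℕ)) (φ : ℕ) : Bool :=
  and (gl.all fun p => and (Nat.beq (digit E (digit φ p.1)) (digit φ p.2))
      (Nat.beq (digit E (digit φ p.2)) (digit φ p.1)))
    (and (fl.all fun p => (List.range p.2).all fun t =>
        Nat.beq (digit F (digit φ (p.1 + t))) (digit φ (p.1 + (t + 1) % p.2)))
      (and ((List.range m).all fun i => Nat.blt (digit φ i) m)
        ((List.range m).all fun j => (List.range m).any fun i => Nat.beq (digit φ i) j)))

/-- A complete patch with `n` darts is isomorphic to a tabulated hypermap from the list `ts`, by an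
isomorphism that maps the dart `0` to one of the darts `0, …, r - 1`. -/
def isListed (n r : ℕ) (ts : List (ℕ × ℕ)) (m : ℕ) (gl fl : List (ℕ × ℕ)) : Bool :=
  and (isComplete m gl fl) (or (not (Nat.beq m n)) (ts.any fun t => (List.range r).any fun d =>
    match fl.reverse with
    | [] => false
    | (_, k) :: fl' =>
      putOrbit t.2 (extendMap t.1 t.2 (isIso t.1 t.2 m gl fl) gl.reverse fl') d k d 0 0))

/-- It does not matter how the table `φ'` was found: it is tested by `k`. -/
theorem putOrbit_exists {F b n a s φ : ℕ} {k : ℕ → Bool} (h : putOrbit F k b n a s φ = true) :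
    ∃ φ', k φ' = true := by
  induction n generalizing a s φ with
  | zero => exact ⟨φ, (Bool.and_eq_true_iff.1 h).2⟩
  | succ n ih =>
    rw [putOrbit, force_eq, force_eq] at h
    exact ih h

theorem extendMap_exists {E F : ℕ} {k : ℕ → Bool} {gl fl : List (ℕ × ℕ)} {φ : ℕ}
    (h : extendMap E F k gl fl φ = true) : ∃ φ', k φ' = true := by
  induction gl generalizing fl φ with
  | nil => exact ⟨φ, by simpa [extendMap] using h⟩
  | cons p gl ih =>
    cases fl with
    | nil => exact ih (Bool.and_eq_true_iff.1 h).2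
    | cons q fl =>
      rw [extendMap] at h
      cases hb : Nat.beq p.2 q.1 with
      | true =>
        rw [hb, cond_true, force_eq] at h
        obtain ⟨φ', h'⟩ := putOrbit_exists h
        exact ih h'
      | false =>
        rw [hb, cond_false] at h
        exact ih (Bool.and_eq_true_iff.1 h).2

variable {D : Type*} {H : Hypermap D} {rem : List ℕ} {m : ℕ} {gl fl : List (ℕ × ℕ)} {A : ℕ → D}
  {a : Perm D}

theorem isComplete_spec (h : isComplete m gl fl = true) :
    0 < m ∧ ∀ i < m, (∃ p ∈ gl, i = p.1 ∨ i = p.2) ∧ ∃ p ∈ fl, ∃ t < p.2, i = p.1 + t := by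
  simp only [isComplete, Bool.and_eq_true, List.all_eq_true, List.any_eq_true, Bool.or_eq_true,
    List.mem_range] at h
  refine ⟨Nat.le_of_ble_eq_true h.1, fun i hi => ?_⟩
  obtain ⟨⟨p, hp, hpi⟩, q, hq, h1, h2⟩ := h.2 i hi
  have h1 := Nat.le_of_ble_eq_true h1
  have h2 : i + 1 ≤ q.1 + q.2 := Nat.le_of_ble_eq_true h2
  exact ⟨⟨p, hp, hpi.imp Nat.eq_of_beq_eq_true Nat.eq_of_beq_eq_true⟩, q, hq, i - q.1,
    by omega, by omega⟩

/-- The darts of a complete patch are closed under the edge and the face map, so they are all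
darts of the connected hypermap `H`. -/
theorem Realizes.surjective (hH : IsSearchable H) (h : Realizes H [] rem m gl fl A a)
    (hc : isComplete m gl fl = true) (d : D) : ∃ i < m, A i = d := by
  obtain ⟨hm, hc⟩ := isComplete_spec hc
  obtain ⟨Fs, hFs, -⟩ := h.faces
  have hstep : ∀ d, (∃ i < m, A i = d) → ∃ i < m, A i = H.e d := by
    rintro _ ⟨i, hi, rfl⟩
    obtain ⟨⟨p, hp, hpi⟩, -⟩ := hc i hi
    have h1 := h.glued p hp
    have h2 := h.glued_lt p hp
    rcases hpi with rfl | rfl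
    · exact ⟨p.2, h2.2, h1.symm⟩
    · exact ⟨p.1, h2.1, by rw [← h1, hH.plain]⟩
  have := compSetoid.apply_eq_of_invariant (φ := fun d => ∃ i < m, A i = d) (fun d => propext
    ⟨fun hd => by simpa only [hH.plain d] using hstep _ hd, hstep d⟩) (fun d => propext (by
      rw [hFs, hFs, Hypermap.face_f])) (Hypermap.compSetoid_of_isConnected hH.planar.1 (A 0) d)
  exact this.mp ⟨0, hm, rfl⟩

theorem Realizes.card_eq (hH : IsSearchable H) (h : Realizes H [] rem m gl fl A a)
    (hc : isComplete m gl fl = true) : Nat.card D = m := by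
  rw [← Nat.card_fin m]
  refine (Nat.card_congr (Equiv.ofBijective (fun i : Fin m => A i) ⟨fun i j hij => ?_,
    fun d => ?_⟩)).symm
  · exact Fin.ext (h.inj i i.2 j j.2 hij)
  · obtain ⟨i, hi, rfl⟩ := h.surjective hH hc d
    exact ⟨⟨i, hi⟩, rfl⟩

theorem Realizes.isTabulated [Finite D] (hH : IsSearchable H)
    (h : Realizes H [] rem m gl fl A a) (hc : isComplete m gl fl = true) {E F φ : ℕ}
    (hφ : isIso E F m gl fl φ = true) : IsTabulated H m E F := by
  have hsurj := h.surjective hH hc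
  choose idx hidx hAidx using hsurj
  have hinv : ∀ i < m, idx (A i) = i := fun i hi => h.inj _ (hidx _) _ hi (hAidx _)
  simp only [isIso, Bool.and_eq_true, List.all_eq_true, List.any_eq_true, List.mem_range] at hφ
  obtain ⟨hgl, hfl, hlt, hsur⟩ := hφ
  let g : D → Fin m := fun d => ⟨digit φ (idx d), Nat.le_of_ble_eq_true (hlt _ (hidx d))⟩
  have hg : ∀ i < m, (g (A i)).val = digit φ i := fun i hi => by
    change digit φ (idx (A i)) = _
    rw [hinv i hi]
  have hgsurj : Function.Surjective g := fun j => by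
    obtain ⟨i, hi, hij⟩ := hsur j j.2
    exact ⟨A i, Fin.ext ((hg i hi).trans (Nat.eq_of_beq_eq_true hij))⟩
  have hgbij : Function.Bijective g := hgsurj.bijective_of_nat_card_le (by
    rw [Nat.card_fin, h.card_eq hH hc])
  refine ⟨Equiv.ofBijective g hgbij, fun d => ?_⟩
  obtain ⟨hgd, q, hq, t, ht, hqt⟩ := (isComplete_spec hc).2 _ (hidx d)
  obtain ⟨i, hi, hid⟩ : ∃ i < m, A i = d := ⟨idx d, hidx d, hAidx d⟩
  rw [show idx d = i by rw [← hid, hinv i hi]] at hgd hqt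
  subst hid
  simp only [Equiv.ofBijective_apply]
  constructor
  · obtain ⟨p, hp, hpi⟩ := hgd
    have h1 := h.glued p hp
    have h2 := h.glued_lt p hp
    have h3 := hgl p hp
    rcases hpi with rfl | rfl
    · rw [h1, hg _ h2.2, hg _ h2.1]
      exact (Nat.eq_of_beq_eq_true h3.1).symm
    · have h4 : H.e (A p.2) = A p.1 := by rw [← h1, hH.plain]
      rw [h4, hg _ h2.2, hg _ h2.1]
      exact (Nat.eq_of_beq_eq_true h3.2).symm
  · have h1 := h.face q hq t ht
    have h2 := h.face_le q hq
    have h3 : (t + 1) % q.2 < q.2 := Nat.mod_lt _ (by omega)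
    subst hqt
    rw [h1, hg _ (by omega), hg _ (by omega)]
    exact (Nat.eq_of_beq_eq_true (hfl q hq t ht)).symm

theorem Realizes.exists_isTabulated [Finite D] (hH : IsSearchable H)
    (h : Realizes H [] rem m gl fl A a) {r : ℕ} {ts : List (ℕ × ℕ)}
    (hl : isListed (Nat.card D) r ts m gl fl = true) :
    ∃ t ∈ ts, IsTabulated H (Nat.card D) t.1 t.2 := by
  obtain ⟨hc, hl⟩ := Bool.and_eq_true_iff.1 hl
  have hcard := h.card_eq hH hc
  rw [hcard] at hl ⊢
  rw [Nat.beq_refl, Bool.not_true, Bool.false_or, List.any_eq_true] at hl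
  obtain ⟨t, ht, hl⟩ := hl
  obtain ⟨d, -, hl⟩ := List.any_eq_true.1 hl
  refine ⟨t, ht, ?_⟩
  split at hl
  · exact absurd hl (by simp)
  · obtain ⟨φ, hφ⟩ := putOrbit_exists hl
    obtain ⟨φ', hφ'⟩ := extendMap_exists hφ
    exact h.isTabulated hH hc hφ'

end PatchSearch

end Compare

/-! ### The hypermaps of the list -/

section Tables

open Equiv Equiv.Perm

namespace PatchSearch

/-- The table of the edge map of `contactHypermap i`, for the numbering of its darts in the order
of the list of faces. -/
def edgeTable : Fin 8 → ℕ :=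
  ![0x4963954cb44f18d5c340729420224404530096eb20aefa63a2d999aa175f8a769c91e6d8,
    0x49638d5e05538d13d99c72aa202244045900aeea4ba2f98696db0352175f89069c31e6d8,
    0x65259a9115537692022440459402eab4f3ab9c69aca036171ca6cc8633547a04227dc,
    0x4979164d05043eb14229b7467c180e008b2a327a6d0e895a2d53611d825e8e6462719,
    0x4d71d651044c3d220b38908a14119801ab2a129b649e89610e689e823adb75535f719,
    0x4d76965104613d53439882ca1411ab004b2a929b479e894c8ce7de0a049b758889719,
    0x4d73ce62159479241aa0c0e520a1a2029b272e6b641e3aea12055c09d45b04d7c9159,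
    0xa6c26e163be61282a0a8d2247437cb5c64566d8087390652053880725b6151aae77953cc]

/-- The table of the face map of `contactHypermap i`. -/
def faceTable : Fin 8 → ℕ :=
  ![0xb6fbaab2b9e9a249a586389e81f6dd71869951759541349130f38d20b289107185003081,
    0xb6fbaab2b9e9a249a586389e81f6dd71869951759541349130f38d20b289107185003081,
    0xaedb28aa99679a29237e181c79d61b69951759541349130f38d20b289107185003081,
    0xaedb28aa99679a29237e181c79d65b69561759151348d40f38930b285207180103081,
    0xaedb28aa99679a29237e181c79d65b69561759151348d40f38930b285207180103081,
    0xaedb28aa99679a29237e181c79d65b69561759151348d40f38930b285207180103081,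
    0xaedb28aa99679a29237e181c79d65b69561759151348d40f38930b285207180103081,
    0xb6fbaab2b9e9a249a586389e81f6dd7186995575925133d140c38d18b289207005103081]

/-- The tables of the edge map of the opposites of `contactHypermap 3` and `contactHypermap 5`, the
two chiral hypermaps of the list, for a numbering that also starts with the darts of the pentagon.
The other entries are not used. -/
def oppositeEdgeTable : Fin 8 → ℕ :=
  ![0, 0, 0, 0x6224d43570104460ec65e2e00873c186da0916aac49666cca4e7c858a7245528dd6a7,
    0, 0x61b5113577d048e11614c9c608bb011eda2202b225aa6264a607033d365e86329d695, 0, 0]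

/-- The tables of the face map that belong to `oppositeEdgeTable`. -/
def oppositeFaceTable : Fin 8 → ℕ :=
  ![0, 0, 0, 0xb2bb69a2a9a59e38a481f85d71e6996d759561349150f38d40b289307185203081004,
    0, 0xb2bb69a2a9a59e38a481f85d71e6996d759561349150f38d40b289307185203081004, 0, 0]

/-- The darts of `contactHypermap i`. -/
def contactDarts (i : Fin 8) : List (Fin 12 × Fin 12) := (contactFaces i).flatMap faceDarts

set_option maxRecDepth 100000 in
theorem contactDarts_nodup : ∀ i, (contactDarts i).Nodup := by
  decide +kernel

set_option maxRecDepth 100000 in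
theorem contactDarts_tables : ∀ (i : Fin 8) (j : Fin (contactDarts i).length),
    (contactDarts i)[digit (edgeTable i) j]? = some (swapPerm ((contactDarts i).get j)) ∧
    (contactDarts i)[digit (faceTable i) j]? =
      some (facePerm (contactFaces i) ((contactDarts i).get j)) := by
  decide +kernel

theorem contactHypermap_isTabulated (i : Fin 8) : IsTabulated (contactHypermap i)
    (contactDarts i).length (edgeTable i) (faceTable i) := by
  let g : Fin (contactDarts i).length ≃ {p // IsContactDart i p} := (contactDarts_nodup i).getEquiv
  have key : ∀ (j : Fin (contactDarts i).length) (k : ℕ) (d : {p // IsContactDart i p}),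
      (contactDarts i)[k]? = some d.1 → (g.symm d).val = k := by
    intro j k d h
    obtain ⟨hk, h⟩ := List.getElem?_eq_some_iff.1 h
    have : g ⟨k, hk⟩ = d := Subtype.ext h
    rw [← this, g.symm_apply_apply]
  refine ⟨g.symm, fun d => ?_⟩
  obtain ⟨j, rfl⟩ := g.surjective d
  obtain ⟨h1, h2⟩ := contactDarts_tables i j
  rw [g.symm_apply_apply]
  exact ⟨key j _ _ h1, key j _ _ h2⟩

theorem IsTabulated.opposite {D : Type*} {H : Hypermap D} {n E F E' F' : ℕ}
    (h : IsTabulated H n E F)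
    (hE : ∀ j < n, digit E' (digit F (digit E j)) = digit F j)
    (hF : ∀ j < n, digit F' (digit F j) = j) :
    IsTabulated H.opposite n E' F' := by
  obtain ⟨g, hg⟩ := h
  refine ⟨g, fun d => ⟨?_, ?_⟩⟩
  · obtain ⟨y, rfl⟩ := (H.f * H.e).surjective d
    have h1 : H.opposite.e ((H.f * H.e) y) = H.f y := by
      change H.f (H.n ((H.f * H.e) y)) = H.f y
      rw [Hypermap.n_eq]
      congr 1
      exact Equiv.symm_apply_apply _ _
    rw [h1, mul_apply, (hg _).2, (hg _).2, (hg _).1, hE _ (g y).2]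
  · obtain ⟨y, rfl⟩ := H.f.surjective d
    have h1 : H.opposite.f (H.f y) = y := Equiv.symm_apply_apply _ _
    rw [h1, (hg _).2, hF _ (g y).2]

theorem opposite_isTabulated {i : Fin 8} (hi : i = 3 ∨ i = 5) :
    IsTabulated (contactHypermap i).opposite 46 (oppositeEdgeTable i) (oppositeFaceTable i) := by
  rcases hi with rfl | rfl
  · exact (contactHypermap_isTabulated 3).opposite (by decide +kernel) (by decide +kernel)
  · exact (contactHypermap_isTabulated 5).opposite (by decide +kernel) (by decide +kernel)

end PatchSearch

end Tables

/-! ### Orbits and counting -/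

section Counting

open Equiv Equiv.Perm PatchSearch

variable {D : Type*}

theorem PermOrbit.sum_ncard_darts [Finite D] (g : Perm D) [Fintype (PermOrbit g)] :
    ∑ O : PermOrbit g, O.darts.ncard = Nat.card D := by
  classical
  have := Fintype.ofFinite D
  rw [Nat.card_eq_fintype_card, ← Finset.card_univ,
    Finset.card_eq_sum_card_fiberwise (f := PermOrbit.of g) (t := Finset.univ) (by simp)]
  refine Finset.sum_congr rfl fun O _ => ?_
  rw [← Set.ncard_coe_finset]
  congr 1
  ext x
  simp [PermOrbit.darts]

namespace Hypermap

variable {H : Hypermap D}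

theorem sameCycle_e_iff (hp : H.IsPlain) {x y : D} : H.e.SameCycle x y ↔ y = x ∨ y = H.e x := by
  constructor
  · intro h
    have := h.apply_eq_of_invariant (φ := fun z => z = x ∨ z = H.e x) fun z => propext
      ⟨fun hz => by
        rcases hz with hz | hz
        · exact Or.inr (by rw [← hz, hp])
        · exact Or.inl (H.e.injective hz),
      fun hz => by
        rcases hz with rfl | rfl
        · exact Or.inr rfl
        · exact Or.inl (hp x)⟩
    exact this.mp (Or.inl rfl)
  · rintro (rfl | rfl)
    · exact SameCycle.refl _ _
    · exact ⟨1, by rw [zpow_one]⟩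

theorem node_f_eq (hp : H.IsPlain) (x : D) :
    PermOrbit.of H.n (H.f x) = PermOrbit.of H.n (H.e x) := by
  refine Quotient.sound (sameCycle_n_iff.2 (SameCycle.symm ⟨1, ?_⟩))
  rw [zpow_one, mul_apply, hp]

theorem of_n_eq_iff {x y : D} :
    PermOrbit.of H.n x = PermOrbit.of H.n y ↔ (H.f * H.e).SameCycle x y :=
  ⟨fun h => sameCycle_n_iff.1 (Quotient.eq.1 h), fun h => Quotient.sound (sameCycle_n_iff.2 h)⟩

theorem ncard_node_darts [Finite D] (x : D) :
    (PermOrbit.of H.n x).darts.ncard = {y | (H.f * H.e).SameCycle x y}.ncard := by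
  congr 1
  ext y
  exact of_n_eq_iff.trans ⟨SameCycle.symm, SameCycle.symm⟩

theorem two_mul_card_edge [Finite D] (hp : H.IsPlain) (hne : ∀ x, H.e x ≠ x) :
    2 * Nat.card H.Edge = Nat.card D := by
  classical
  have := Fintype.ofFinite H.Edge
  rw [← PermOrbit.sum_ncard_darts H.e, Finset.sum_congr rfl (g := fun _ => 2), Finset.sum_const,
    Finset.card_univ, Nat.card_eq_fintype_card, smul_eq_mul, mul_comm]
  intro O _
  induction O using Quotient.inductionOn with
  | h x =>
    have : PermOrbit.darts (⟦x⟧ : H.Edge) = {x, H.e x} := by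
      ext y
      have : y ∈ PermOrbit.darts (⟦x⟧ : H.Edge) ↔ H.e.SameCycle x y :=
        ⟨fun h => (Quotient.eq.1 h : H.e.SameCycle y x).symm, fun h => Quotient.sound h.symm⟩
      rw [this, sameCycle_e_iff hp]
      rfl
    rw [this, Set.ncard_pair (hne x).symm]

theorem sum_faces {M : Type*} [AddCommMonoid M] [Fintype H.Face] [Finite D]
    (hs : ∀ F : H.Face, 3 ≤ F.darts.ncard ∧ F.darts.ncard ≤ 8) (φ : ℕ → M) :
    ∑ F : H.Face, φ F.darts.ncard = ∑ k ∈ Finset.Icc 3 8, H.numFaces k • φ k := by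
  classical
  rw [← Finset.sum_fiberwise_of_maps_to (s := Finset.univ) (t := Finset.Icc 3 8)
    (g := fun F : H.Face => F.darts.ncard) fun F _ => Finset.mem_Icc.2 (hs F)]
  refine Finset.sum_congr rfl fun k _ => ?_
  rw [Finset.sum_congr rfl (g := fun _ => φ k), Finset.sum_const]
  · congr 1
    rw [numFaces, ← Set.ncard_coe_finset]
    congr 1
    ext F
    simp
  · intro F hF
    rw [(Finset.mem_filter.1 hF).2]

namespace HasTameContact

variable (hH : H.HasTameContact)

include hH

theorem node_ne_node_e (x : D) : PermOrbit.of H.n x ≠ PermOrbit.of H.n (H.e x) :=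
  hH.no_loops x (H.e x) ⟨1, by rw [zpow_one]⟩ (hH.nondegenerate x).symm

theorem node_ne_node_f (x : D) : PermOrbit.of H.n x ≠ PermOrbit.of H.n (H.f x) := by
  rw [node_f_eq hH.plain]
  exact hH.node_ne_node_e x

theorem faceSize_bounds (x : D) : 3 ≤ H.faceSize x ∧ H.faceSize x ≤ 8 := hH.face_size _

theorem isSearchable : IsSearchable H where
  planar := hH.planar
  plain := hH.plain
  nondegenerate := hH.nondegenerate
  no_loops := fun d h => hH.node_ne_node_e d (of_n_eq_iff.2 h)
  faceSize := hH.faceSize_bounds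

variable [Finite D]

/-- Successive edges of a face are different, since otherwise the node between them would have only
one dart. -/
theorem edge_ne_edge_f (x : D) : PermOrbit.of H.e x ≠ PermOrbit.of H.e (H.f x) := by
  intro h
  have h' : H.e.SameCycle x (H.f x) := Quotient.eq.1 h
  rcases (sameCycle_e_iff hH.plain).1 h' with hx | hx
  · exact hH.node_ne_node_f x (by rw [hx])
  · have h1 : (H.f * H.e) (H.e x) = H.e x := by rw [mul_apply, hH.plain, hx]
    have h2 : {y | (H.f * H.e).SameCycle (H.e x) y} = {H.e x} := by
      ext y
      rw [Set.mem_singleton_iff]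
      constructor
      · intro hy
        exact (SameCycle.eq_of_left hy h1).symm
      · rintro rfl
        exact SameCycle.refl _ _
    have h3 := (hH.node_size (PermOrbit.of H.n (H.e x))).1
    rw [ncard_node_darts, h2, Set.ncard_singleton] at h3
    omega

/-- A triangle or a quadrilateral passes only once through a node. -/
theorem eq_of_node_eq_of_face_eq {x y : D} (hs : H.faceSize x ≤ 4)
    (hn : PermOrbit.of H.n x = PermOrbit.of H.n y) (hf : PermOrbit.of H.f x = PermOrbit.of H.f y) :
    x = y := by
  obtain ⟨j, hj, rfl⟩ := exists_pow_eq_of_face_eq hf.symm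
  have h3 := (hH.faceSize_bounds x).1
  have hper := pow_faceSize H x
  by_contra hne
  have hlast : j + 1 ≠ H.faceSize x := by
    intro hc
    refine hH.node_ne_node_f ((H.f ^ j) x) ?_
    rw [← mul_apply, ← pow_succ', hc, hper]
    exact hn.symm
  have h0 : j ≠ 0 := by
    rintro rfl
    exact hne rfl
  have h1 : j ≠ 1 := by
    rintro rfl
    exact hH.node_ne_node_f x hn
  -- a quadrilateral with `x` and `f (f x)` in one node has two edges between the same nodes
  have h2 : j = 2 := by omega
  subst h2
  refine hH.edge_ne_edge_f x (hH.no_double_join _ _ (hH.node_ne_node_f x) _ _ ⟨x, rfl, rfl⟩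
    ⟨H.e x, ?_, (node_f_eq hH.plain x).symm⟩ ⟨H.e (H.f x), ?_, ?_⟩ ⟨H.f x, rfl, rfl⟩)
  · exact Quotient.sound ((sameCycle_e_iff hH.plain).2 (Or.inr (hH.plain x).symm))
  · exact Quotient.sound ((sameCycle_e_iff hH.plain).2 (Or.inr (hH.plain _).symm))
  · change PermOrbit.of H.n (H.e (H.f x)) = _
    rw [← node_f_eq hH.plain, hn]
    rfl

theorem ncard_faces_meeting (x : D) (hs : ∀ y, (H.f * H.e).SameCycle x y → H.faceSize y ≤ 4)
    (p : ℕ → Prop) : {F : H.Face | F.Meets (PermOrbit.of H.n x) ∧ p F.darts.ncard}.ncard =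
      {y | (H.f * H.e).SameCycle x y ∧ p (H.faceSize y)}.ncard := by
  have himg : {F : H.Face | F.Meets (PermOrbit.of H.n x) ∧ p F.darts.ncard} =
      PermOrbit.of H.f '' {y | (H.f * H.e).SameCycle x y ∧ p (H.faceSize y)} := by
    ext F
    constructor
    · rintro ⟨⟨y, hy, hy'⟩, hF⟩
      have hy : PermOrbit.of H.f y = F := hy
      subst hy
      exact ⟨y, ⟨(of_n_eq_iff.1 hy').symm, hF⟩, rfl⟩
    · rintro ⟨y, ⟨hy, hp⟩, rfl⟩
      exact ⟨⟨y, rfl, of_n_eq_iff.2 hy.symm⟩, hp⟩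
  rw [himg, Set.InjOn.ncard_image]
  intro y hy z hz hyz
  exact hH.eq_of_node_eq_of_face_eq (hs y hy.1)
    (of_n_eq_iff.2 (hy.1.symm.trans hz.1)) hyz

/-- The types of nodes that meet only triangles and quadrilaterals. -/
theorem node_type (x : D) (hs : ∀ y, (H.f * H.e).SameCycle x y → H.faceSize y ≤ 4) :
    ({y | (H.f * H.e).SameCycle x y ∧ H.faceSize y = 3}.ncard,
      {y | (H.f * H.e).SameCycle x y ∧ H.faceSize y = 4}.ncard) ∈
      ({(0, 3), (1, 3), (2, 2)} : Set (ℕ × ℕ)) := by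
  obtain ⟨τ, hτ, hlt⟩ := hH.weights
  set p := {y | (H.f * H.e).SameCycle x y ∧ H.faceSize y = 3}.ncard with hp
  set q := {y | (H.f * H.e).SameCycle x y ∧ H.faceSize y = 4}.ncard with hq
  have htype : H.HasType (PermOrbit.of H.n x) p q 0 := by
    refine ⟨?_, hH.ncard_faces_meeting x hs (· = 3), hH.ncard_faces_meeting x hs (· = 4)⟩
    have h1 := hH.ncard_faces_meeting x hs (fun _ => True)
    simp only [and_true] at h1
    rw [h1, add_zero, hp, hq, ← Set.ncard_union_eq]
    · congr 1
      ext y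
      simp only [Set.mem_ofPred_eq, Set.mem_union]
      refine ⟨fun h => ?_, fun h => h.elim And.left And.left⟩
      have h2 := hs y h
      have h3 := (hH.faceSize_bounds y).1
      have : H.faceSize y = 3 ∨ H.faceSize y = 4 := by omega
      exact this.imp (fun h' => ⟨h, h'⟩) fun h' => ⟨h, h'⟩
    · refine Set.disjoint_left.2 fun y hy hy' => ?_
      have h1 := hy.2
      have h2 := hy'.2
      omega
  have h1 := hτ.node_bound _ _ _ htype
  have h2 : ∑ᶠ F ∈ {F : H.Face | F.Meets (PermOrbit.of H.n x)}, τ F ≤ ∑ᶠ F, τ F := by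
    classical
    have := Fintype.ofFinite H.Face
    rw [finsum_mem_eq_finite_toFinset_sum _ (Set.toFinite _), finsum_eq_sum_of_fintype]
    exact Finset.sum_le_sum_of_subset_of_nonneg (Finset.subset_univ _) fun F _ _ => hτ.nonneg F
  have h3 : contactB p q < tgt := (h1.trans h2).trans_lt hlt
  unfold contactB at h3
  split_ifs at h3 with h4 h5
  · rcases h4 with h4 | h4
    · exact Or.inl h4
    · exact Or.inr (Or.inl h4)
  · exact Or.inr (Or.inr h5)
  · exact absurd h3 (lt_irrefl _)

theorem nat_card_le : Nat.card D ≤ 48 := by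
  have := Fintype.ofFinite H.Node
  rw [← PermOrbit.sum_ncard_darts H.n]
  refine (Finset.sum_le_card_nsmul _ _ 4 fun v _ => (hH.node_size v).2).trans ?_
  rw [Finset.card_univ, ← Nat.card_eq_fintype_card, hH.node_count]
  norm_num

/-- If there are 48 darts then all nodes have four darts. -/
theorem ncard_node_of_card (hc : Nat.card D = 48) (v : H.Node) : v.darts.ncard = 4 := by
  classical
  have := Fintype.ofFinite H.Node
  have h1 := PermOrbit.sum_ncard_darts H.n
  have h2 : ∑ v : H.Node, v.darts.ncard = ∑ _v : H.Node, 4 := by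
    rw [h1, hc, Finset.sum_const, Finset.card_univ, ← Nat.card_eq_fintype_card, hH.node_count]
    rfl
  exact (Finset.sum_eq_sum_iff_of_le fun v _ => (hH.node_size v).2).1 h2 v (Finset.mem_univ v)

/-- The bounds `d₁` on the weights of the faces, multiplied by `1000`. -/
theorem weight_sum_lt : 206 * H.numFaces 4 + 476 * H.numFaces 5 + 746 * H.numFaces 6 +
    1016 * H.numFaces 7 + 1286 * H.numFaces 8 < 1541 := by
  have := Fintype.ofFinite H.Face
  obtain ⟨τ, hτ, hlt⟩ := hH.weights
  rw [finsum_eq_sum_of_fintype] at hlt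
  have h1 := (Finset.sum_le_sum fun F (_ : F ∈ Finset.univ) => hτ.face_bound F).trans_lt hlt
  rw [sum_faces hH.face_size contactD] at h1
  have h2 : Finset.Icc 3 8 = {3, 4, 5, 6, 7, 8} := rfl
  rw [h2] at h1
  simp only [nsmul_eq_mul, contactD, tgt] at h1
  norm_num at h1
  have h3 : (206 * H.numFaces 4 + 476 * H.numFaces 5 + 746 * H.numFaces 6 +
    1016 * H.numFaces 7 + 1286 * H.numFaces 8 : ℝ) < 1541 := by linarith
  exact_mod_cast h3

theorem card_eq_sum : Nat.card D = 3 * H.numFaces 3 + 4 * H.numFaces 4 + 5 * H.numFaces 5 +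
    6 * H.numFaces 6 + 7 * H.numFaces 7 + 8 * H.numFaces 8 := by
  have := Fintype.ofFinite H.Face
  rw [← PermOrbit.sum_ncard_darts H.f, sum_faces hH.face_size (fun k => k),
    show Finset.Icc 3 8 = {3, 4, 5, 6, 7, 8} from rfl]
  simp
  ring

theorem card_face_eq_sum : Nat.card H.Face = H.numFaces 3 + H.numFaces 4 + H.numFaces 5 +
    H.numFaces 6 + H.numFaces 7 + H.numFaces 8 := by
  have := Fintype.ofFinite H.Face
  have h := sum_faces hH.face_size (fun _ => 1)
  rw [show Finset.Icc 3 8 = {3, 4, 5, 6, 7, 8} from rfl] at h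
  simp at h
  rw [Nat.card_eq_fintype_card, h]
  ring

theorem numFaces_eq_zero {k : ℕ} (hk : 8 < k) : H.numFaces k = 0 := by
  rw [numFaces, Set.ncard_eq_zero (Set.toFinite _)]
  ext F
  have := (hH.face_size F).2
  simp only [Set.mem_ofPred_eq, Set.mem_empty_iff_false, iff_false]
  omega

end HasTameContact

end Hypermap

end Counting

/-! ### Types of nodes and numbers of faces -/

section Types

open Equiv Equiv.Perm PatchSearch

namespace PatchSearch

/-- A set of codes that contains the codes of the parts of the nodes in `generalTable`. For the sake
of a simple description it is closed under subtracting the codes of corners, whether or not there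
are such corners to be removed; this adds only numbers that are not codes of sets of corners. -/
def incompleteMask : ℕ :=
  1996235123251536204296852573235807877667403123487190774704396270821907436270064762879

/-- The codes of nodes with four corners that either meet a face with more than four sides, or
meet `p` triangles and `q` quadrilaterals, where `(p, q)` is `(1, 3)` or `(2, 2)`. -/
def fourCornerTable : NodeTable where
  complete := 1996235123251536204135773809485432993630684506848357505660413764304052954368550371328
  incomplete := incompleteMask

/-- The codes of nodes with two, three or four corners that either meet a face with more than four
sides, or meet `p` triangles and `q` quadrilaterals, where `(p, q)` is `(0, 3)`, `(1, 3)`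
or `(2, 2)`. -/
def generalTable : NodeTable where
  complete := 1996235123251536204136190100595422102912261420700248247412525293428797689501377888256
  incomplete := incompleteMask

theorem bit_incompleteMask_of_add (c k : ℕ) (h : bit incompleteMask (c + sizeCode k) = true) :
    bit incompleteMask c = true := by
  have hk : sizeCode k = 72 ∨ sizeCode k = 65 ∨ sizeCode k = 64 := by
    unfold sizeCode
    cases Nat.beq k 3 <;> cases Nat.beq k 4 <;> simp
  have key : ∀ c < 512, (bit incompleteMask (c + 72) = true → bit incompleteMask c = true) ∧
      (bit incompleteMask (c + 65) = true → bit incompleteMask c = true) ∧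
      (bit incompleteMask (c + 64) = true → bit incompleteMask c = true) := by
    decide +kernel
  by_cases hc : c < 512
  · obtain ⟨h1, h2, h3⟩ := key c hc
    rcases hk with hk | hk | hk <;> rw [hk] at h
    · exact h1 h
    · exact h2 h
    · exact h3 h
  · rw [bit_eq_false (n := 512) (by decide +kernel) (by omega)] at h
    exact absurd h (by simp)

theorem bit_incompleteMask_of_complete (c : ℕ) :
    (bit fourCornerTable.complete c = true → bit incompleteMask c = true) ∧
    (bit generalTable.complete c = true → bit incompleteMask c = true) := by
  have key : ∀ c < 512, (bit fourCornerTable.complete c = true → bit incompleteMask c = true) ∧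
      (bit generalTable.complete c = true → bit incompleteMask c = true) := by
    decide +kernel
  by_cases hc : c < 512
  · exact key c hc
  · have h4 : bit fourCornerTable.complete c = false :=
      bit_eq_false (n := 512) (by decide +kernel) (by omega)
    have h : bit generalTable.complete c = false :=
      bit_eq_false (n := 512) (by decide +kernel) (by omega)
    simp [h4, h]

/-- The condition on the numbers of triangles, of quadrilaterals and of larger faces at a node. -/
def IsNodeType (p q r : ℕ) : Prop :=
  r = 0 → (p, q) = (0, 3) ∨ (p, q) = (1, 3) ∨ (p, q) = (2, 2)

instance (p q r : ℕ) : Decidable (IsNodeType p q r) := by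
  unfold IsNodeType
  infer_instance

theorem bit_fourCornerTable {p q r : ℕ} (h : IsNodeType p q r) (h4 : p + q + r = 4) :
    bit fourCornerTable.complete (72 * p + 65 * q + 64 * r) = true := by
  have key : ∀ p < 5, ∀ q < 5, ∀ r < 5, IsNodeType p q r → p + q + r = 4 →
      bit fourCornerTable.complete (72 * p + 65 * q + 64 * r) = true := by
    decide +kernel
  exact key p (by omega) q (by omega) r (by omega) h h4

theorem bit_generalTable {p q r : ℕ} (h : IsNodeType p q r) (h2 : 2 ≤ p + q + r)
    (h4 : p + q + r ≤ 4) : bit generalTable.complete (72 * p + 65 * q + 64 * r) = true := by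
  have key : ∀ p < 5, ∀ q < 5, ∀ r < 5, IsNodeType p q r ∧ 2 ≤ p + q + r ∧ p + q + r ≤ 4 →
      bit generalTable.complete (72 * p + 65 * q + 64 * r) = true := by
    decide +kernel
  exact key p (by omega) q (by omega) r (by omega) ⟨h, h2, h4⟩

end PatchSearch

variable {D : Type*} {H : Hypermap D}

namespace Hypermap.HasTameContact

/-- The code of a node is determined by its numbers of triangles, quadrilaterals and larger faces,
which the bounds on the weights at nodes restrict. -/
theorem exists_nodeType [Fintype D] (hH : H.HasTameContact) (d : D) :
    ∃ p q r, H.nodeCode d = 72 * p + 65 * q + 64 * r ∧ IsNodeType p q r ∧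
      p + q + r = (PermOrbit.of H.n d).darts.ncard := by
  classical
  let S : Finset D := Finset.univ.filter fun x => (H.f * H.e).SameCycle d x
  have hS : ∀ x, x ∈ S ↔ (H.f * H.e).SameCycle d x := fun x => by simp [S]
  have hcard : ∀ k, {y | (H.f * H.e).SameCycle d y ∧ H.faceSize y = k}.ncard =
      (S.filter fun x => H.faceSize x = k).card := fun k => by
    rw [← Set.ncard_coe_finset]
    congr 1
    ext x
    simp [hS]
  refine ⟨(S.filter fun x => H.faceSize x = 3).card, (S.filter fun x => H.faceSize x = 4).card,
    (S.filter fun x => H.faceSize x ≠ 3 ∧ H.faceSize x ≠ 4).card, ?_, ?_, ?_⟩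
  · simp only [Finset.card_filter, Finset.mul_sum]
    rw [← Finset.sum_add_distrib, ← Finset.sum_add_distrib]
    have : H.nodeCode d = ∑ x ∈ S, H.cornerCode x :=
      Finset.sum_congr (Finset.ext fun x => by simp [S]) fun _ _ => rfl
    rw [this]
    refine Finset.sum_congr rfl fun x _ => ?_
    rw [cornerCode]
    generalize H.faceSize x = k
    by_cases h3 : k = 3
    · subst h3; rfl
    by_cases h4 : k = 4
    · subst h4; rfl
    have b3 : Nat.beq k 3 = false := by
      rw [← Bool.not_eq_true]
      exact fun h => h3 (Nat.eq_of_beq_eq_true h)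
    have b4 : Nat.beq k 4 = false := by
      rw [← Bool.not_eq_true]
      exact fun h => h4 (Nat.eq_of_beq_eq_true h)
    simp [sizeCode, b3, b4, h3, h4]
  · intro hr
    have hs : ∀ y, (H.f * H.e).SameCycle d y → H.faceSize y ≤ 4 := fun y hy => by
      have := Finset.filter_eq_empty_iff.1 (Finset.card_eq_zero.1 hr) ((hS y).2 hy)
      omega
    rw [← hcard, ← hcard]
    exact hH.node_type d hs
  · rw [ncard_node_darts]
    have h1 : {y | (H.f * H.e).SameCycle d y}.ncard = S.card := by
      rw [← Set.ncard_coe_finset]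
      congr 1
      ext x
      simp [hS]
    rw [h1, Finset.card_filter, Finset.card_filter, Finset.card_filter, Finset.card_eq_sum_ones,
      ← Finset.sum_add_distrib, ← Finset.sum_add_distrib]
    refine Finset.sum_congr rfl fun x _ => ?_
    by_cases h3 : H.faceSize x = 3
    · simp [h3]
    · by_cases h4 : H.faceSize x = 4 <;> simp [h3, h4]

theorem admits_fourCornerTable [Fintype D] (hH : H.HasTameContact) (hc : Nat.card D = 48) :
    fourCornerTable.Admits H where
  nodeCode d := by
    obtain ⟨p, q, r, h1, h2, h3⟩ := hH.exists_nodeType d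
    rw [h1]
    exact bit_fourCornerTable h2 (h3.trans (hH.ncard_node_of_card hc _))
  incomplete_of_complete c := (bit_incompleteMask_of_complete c).1
  incomplete_of_add := bit_incompleteMask_of_add

theorem admits_generalTable [Fintype D] (hH : H.HasTameContact) : generalTable.Admits H where
  nodeCode d := by
    obtain ⟨p, q, r, h1, h2, h3⟩ := hH.exists_nodeType d
    have := hH.node_size (PermOrbit.of H.n d)
    rw [h1]
    exact bit_generalTable h2 (by omega) (by omega)
  incomplete_of_complete c := (bit_incompleteMask_of_complete c).2
  incomplete_of_add := bit_incompleteMask_of_add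

/-- The list of the numbers of faces of sizes `3, …, 8`. -/
noncomputable def _root_.Hypermap.faceNumbers (H : Hypermap D) : List ℕ :=
  [H.numFaces 3, H.numFaces 4, H.numFaces 5, H.numFaces 6, H.numFaces 7, H.numFaces 8]

theorem getD_faceNumbers [Finite D] (hH : H.HasTameContact) (k : ℕ) (hk : 3 ≤ k) :
    H.faceNumbers.getD (k - 3) 0 = H.numFaces k := by
  by_cases h8 : k ≤ 8
  · interval_cases k <;> rfl
  · rw [hH.numFaces_eq_zero (by omega), List.getD_eq_default]
    simp only [faceNumbers, List.length_cons, List.length_nil]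
    omega

/-- Euler's formula, the bound on the degrees of the nodes, and the bound on the sum of the
weights leave few possibilities for the numbers of faces. -/
theorem faceNumbers_cases [Finite D] (hH : H.HasTameContact) :
    (Nat.card D = 48 ∧ (H.faceNumbers = [8, 6, 0, 0, 0, 0] ∨ H.faceNumbers = [9, 4, 1, 0, 0, 0] ∨
      H.faceNumbers = [10, 2, 2, 0, 0, 0] ∨ H.faceNumbers = [11, 0, 3, 0, 0, 0] ∨
      H.faceNumbers = [10, 3, 0, 1, 0, 0] ∨ H.faceNumbers = [11, 1, 1, 1, 0, 0] ∨
      H.faceNumbers = [12, 0, 0, 2, 0, 0] ∨ H.faceNumbers = [11, 2, 0, 0, 1, 0] ∨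
      H.faceNumbers = [12, 0, 1, 0, 1, 0] ∨ H.faceNumbers = [12, 1, 0, 0, 0, 1])) ∨
    (Nat.card D = 46 ∧ (H.faceNumbers = [6, 7, 0, 0, 0, 0] ∨
      H.faceNumbers = [7, 5, 1, 0, 0, 0])) := by
  have h1 := hH.card_eq_sum
  have h2 := hH.card_face_eq_sum
  have h3 := hH.planar.2
  have h4 := two_mul_card_edge hH.plain hH.nondegenerate
  have h5 := hH.weight_sum_lt
  have h6 := hH.nat_card_le
  have h7 := hH.node_count
  rw [faceNumbers]
  generalize H.numFaces 3 = n3 at *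
  generalize H.numFaces 4 = n4 at *
  generalize H.numFaces 5 = n5 at *
  generalize H.numFaces 6 = n6 at *
  generalize H.numFaces 7 = n7 at *
  generalize H.numFaces 8 = n8 at *
  generalize Nat.card D = c at *
  -- Euler's formula determines the number of triangles
  obtain rfl : n3 = 20 - (2 * n4 + 3 * n5 + 4 * n6 + 5 * n7 + 6 * n8) := by omega
  obtain rfl : c = 60 - 2 * (n4 + 2 * n5 + 3 * n6 + 4 * n7 + 5 * n8) := by omega
  have e3 : 6 ≤ n4 + 2 * n5 + 3 * n6 + 4 * n7 + 5 * n8 := by omega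
  have e4 : n8 ≤ 1 := by omega
  have e5 : n7 ≤ 1 := by omega
  have e6 : n6 ≤ 2 := by omega
  have e7 : n5 ≤ 3 := by omega
  have e8 : n4 ≤ 7 := by omega
  clear h1 h2 h3 h4 h6 h7
  interval_cases n8 <;> interval_cases n7 <;> try (exfalso; omega)
  all_goals interval_cases n6 <;> try (exfalso; omega)
  all_goals interval_cases n5 <;> try (exfalso; omega)
  all_goals interval_cases n4 <;> first | (exfalso; omega) | simp

theorem exists_faceSize_eq {k : ℕ} (h : H.numFaces k ≠ 0) : ∃ d, H.faceSize d = k := by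
  obtain ⟨F, hF⟩ := Set.nonempty_of_ncard_ne_zero h
  obtain ⟨d, rfl⟩ := Quotient.exists_rep F
  exact ⟨d, hF⟩

/-- If the search from a face of size `k` succeeds, then `H` is one of the tabulated hypermaps. -/
theorem exists_isTabulated [Fintype D] (hH : H.HasTameContact) {P : NodeTable} (hP : P.Admits H)
    {n r : ℕ} {ts : List (ℕ × ℕ)} {faces : List ℕ} (k : ℕ) (hn : Nat.card D = n)
    (hf : H.faceNumbers = faces) (hk : 3 ≤ k) (hk' : faces.getD (k - 3) 0 ≠ 0)
    {M : ℕ} (hM : 0 < M) (h : ∀ i < M, searchFrom P (isListed n r ts) k faces M i = true) :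
    ∃ t ∈ ts, IsTabulated H n t.1 t.2 := by
  subst hn hf
  rw [hH.getD_faceNumbers k hk] at hk'
  obtain ⟨d, rfl⟩ := exists_faceSize_eq hk'
  obtain ⟨rem, m, gl, fl, A, a, hl, hr⟩ :=
    searchFrom_sound hH.isSearchable hP hH.getD_faceNumbers d hM h
  exact hr.exists_isTabulated hH.isSearchable hl

end Hypermap.HasTameContact

end Types

/-! ### The searches -/

section Classification

open PatchSearch

namespace PatchSearch

/-- The tables of `contactHypermap i`. -/
def tables (i : Fin 8) : ℕ × ℕ := (edgeTable i, faceTable i)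

/-- The tables of the opposite of `contactHypermap i`, for `i = 3` and `i = 5`. The other hypermaps
of the list are isomorphic to their opposites. -/
def oppositeTables (i : Fin 8) : ℕ × ℕ := (oppositeEdgeTable i, oppositeFaceTable i)

set_option maxRecDepth 100000 in
/-- The first of the searches, one for each list of numbers of faces, from which they take their
names. Each of them starts with a face of the largest size that occurs. The second argument of
`isListed` is the number of darts in faces of this size, which come first in the tables: in an
isomorphism the dart `0` of the patch has to correspond to one of them. -/
theorem search_eight_six : ∀ i < 1, searchFrom fourCornerTable
    (isListed 48 24 [tables 0, tables 1])
    4 [8, 6, 0, 0, 0, 0] 1 i = true := by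
  decide +kernel

set_option maxRecDepth 100000 in
theorem search_nine_four_one : ∀ i < 1, searchFrom fourCornerTable
    (isListed 48 0 [])
    5 [9, 4, 1, 0, 0, 0] 1 i = true := by
  decide +kernel

set_option maxRecDepth 100000 in
theorem search_ten_two_two : ∀ i < 1, searchFrom fourCornerTable
    (isListed 48 0 [])
    5 [10, 2, 2, 0, 0, 0] 1 i = true := by
  decide +kernel

set_option maxRecDepth 100000 in
theorem search_eleven_zero_three : ∀ i < 1, searchFrom fourCornerTable
    (isListed 48 0 [])
    5 [11, 0, 3, 0, 0, 0] 1 i = true := by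
  decide +kernel

set_option maxRecDepth 100000 in
theorem search_ten_three_zero_one : ∀ i < 1, searchFrom fourCornerTable
    (isListed 48 0 [])
    6 [10, 3, 0, 1, 0, 0] 1 i = true := by
  decide +kernel

set_option maxRecDepth 100000 in
theorem search_eleven_one_one_one : ∀ i < 1, searchFrom fourCornerTable
    (isListed 48 0 [])
    6 [11, 1, 1, 1, 0, 0] 1 i = true := by
  decide +kernel

set_option maxRecDepth 100000 in
theorem search_twelve_zero_zero_two : ∀ i < 1, searchFrom fourCornerTable
    (isListed 48 12 [tables 7])
    6 [12, 0, 0, 2, 0, 0] 1 i = true := by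
  decide +kernel

set_option maxRecDepth 100000 in
theorem search_eleven_two_zero_zero_one : ∀ i < 1, searchFrom fourCornerTable
    (isListed 48 0 [])
    7 [11, 2, 0, 0, 1, 0] 1 i = true := by
  decide +kernel

set_option maxRecDepth 100000 in
theorem search_twelve_zero_one_zero_one : ∀ i < 1, searchFrom fourCornerTable
    (isListed 48 0 [])
    7 [12, 0, 1, 0, 1, 0] 1 i = true := by
  decide +kernel

set_option maxRecDepth 100000 in
theorem search_twelve_one_zero_zero_zero_one : ∀ i < 1, searchFrom fourCornerTable
    (isListed 48 0 [])
    8 [12, 1, 0, 0, 0, 1] 1 i = true := by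
  decide +kernel

set_option maxRecDepth 100000 in
theorem search_six_seven : ∀ i < 1, searchFrom generalTable
    (isListed 46 28 [tables 2])
    4 [6, 7, 0, 0, 0, 0] 1 i = true := by
  decide +kernel

set_option maxRecDepth 100000 in
theorem search_seven_five_one_part_zero : searchFrom generalTable
    (isListed 46 5 [tables 3, oppositeTables 3, tables 4, tables 5, oppositeTables 5, tables 6])
    5 [7, 5, 1, 0, 0, 0] 6 0 = true := by
  decide +kernel

set_option maxRecDepth 100000 in
theorem search_seven_five_one_part_one : searchFrom generalTable
    (isListed 46 5 [tables 3, oppositeTables 3, tables 4, tables 5, oppositeTables 5, tables 6])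
    5 [7, 5, 1, 0, 0, 0] 6 1 = true := by
  decide +kernel

set_option maxRecDepth 100000 in
theorem search_seven_five_one_part_two : searchFrom generalTable
    (isListed 46 5 [tables 3, oppositeTables 3, tables 4, tables 5, oppositeTables 5, tables 6])
    5 [7, 5, 1, 0, 0, 0] 6 2 = true := by
  decide +kernel

set_option maxRecDepth 100000 in
theorem search_seven_five_one_part_three : searchFrom generalTable
    (isListed 46 5 [tables 3, oppositeTables 3, tables 4, tables 5, oppositeTables 5, tables 6])
    5 [7, 5, 1, 0, 0, 0] 6 3 = true := by
  decide +kernel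

set_option maxRecDepth 100000 in
theorem search_seven_five_one_part_four : searchFrom generalTable
    (isListed 46 5 [tables 3, oppositeTables 3, tables 4, tables 5, oppositeTables 5, tables 6])
    5 [7, 5, 1, 0, 0, 0] 6 4 = true := by
  decide +kernel

set_option maxRecDepth 100000 in
theorem search_seven_five_one_part_five : searchFrom generalTable
    (isListed 46 5 [tables 3, oppositeTables 3, tables 4, tables 5, oppositeTables 5, tables 6])
    5 [7, 5, 1, 0, 0, 0] 6 5 = true := by
  decide +kernel

theorem search_seven_five_one : ∀ i < 6, searchFrom generalTable
    (isListed 46 5 [tables 3, oppositeTables 3, tables 4, tables 5, oppositeTables 5, tables 6])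
    5 [7, 5, 1, 0, 0, 0] 6 i = true := by
  intro i hi
  interval_cases i
  exacts [search_seven_five_one_part_zero, search_seven_five_one_part_one,
    search_seven_five_one_part_two, search_seven_five_one_part_three,
    search_seven_five_one_part_four, search_seven_five_one_part_five]

end PatchSearch

theorem Hypermap.HasTameContact.exists_isIsomorphic {D : Type*} [Finite D] {H : Hypermap D}
    (hH : H.HasTameContact) : ∃ i : Fin 8, H.IsIsomorphic (contactHypermap i) ∨
      H.IsIsomorphic (contactHypermap i).opposite := by
  classical
  have := Fintype.ofFinite D
  have hiso : ∀ i : Fin 8, IsTabulated H (contactDarts i).length (tables i).1 (tables i).2 →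
      ∃ i : Fin 8, H.IsIsomorphic (contactHypermap i) ∨
        H.IsIsomorphic (contactHypermap i).opposite := fun i h =>
    ⟨i, Or.inl (h.isIsomorphic (contactHypermap_isTabulated i))⟩
  have hopp : ∀ i : Fin 8, i = 3 ∨ i = 5 →
      IsTabulated H 46 (oppositeTables i).1 (oppositeTables i).2 →
      ∃ i : Fin 8, H.IsIsomorphic (contactHypermap i) ∨
        H.IsIsomorphic (contactHypermap i).opposite := fun i hi h =>
    ⟨i, Or.inr (h.isIsomorphic (opposite_isTabulated hi))⟩
  have hgen := hH.admits_generalTable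
  rcases hH.faceNumbers_cases with ⟨hc, hf⟩ | ⟨hc, hf⟩
  · have hfour := hH.admits_fourCornerTable hc
    rcases hf with hf | hf | hf | hf | hf | hf | hf | hf | hf | hf
    · obtain ⟨t, ht, h⟩ := hH.exists_isTabulated hfour 4 hc hf (by norm_num) (by norm_num)
        one_pos search_eight_six
      simp only [List.mem_cons, List.not_mem_nil, or_false] at ht
      rcases ht with rfl | rfl
      exacts [hiso 0 h, hiso 1 h]
    · obtain ⟨t, ht, h⟩ := hH.exists_isTabulated hfour 5 hc hf (by norm_num) (by norm_num)
        one_pos search_nine_four_one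
      exact absurd ht List.not_mem_nil
    · obtain ⟨t, ht, h⟩ := hH.exists_isTabulated hfour 5 hc hf (by norm_num) (by norm_num)
        one_pos search_ten_two_two
      exact absurd ht List.not_mem_nil
    · obtain ⟨t, ht, h⟩ := hH.exists_isTabulated hfour 5 hc hf (by norm_num) (by norm_num)
        one_pos search_eleven_zero_three
      exact absurd ht List.not_mem_nil
    · obtain ⟨t, ht, h⟩ := hH.exists_isTabulated hfour 6 hc hf (by norm_num) (by norm_num)
        one_pos search_ten_three_zero_one
      exact absurd ht List.not_mem_nil
    · obtain ⟨t, ht, h⟩ := hH.exists_isTabulated hfour 6 hc hf (by norm_num) (by norm_num)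
        one_pos search_eleven_one_one_one
      exact absurd ht List.not_mem_nil
    · obtain ⟨t, ht, h⟩ := hH.exists_isTabulated hfour 6 hc hf (by norm_num) (by norm_num)
        one_pos search_twelve_zero_zero_two
      obtain rfl := List.mem_singleton.1 ht
      exact hiso 7 h
    · obtain ⟨t, ht, h⟩ := hH.exists_isTabulated hfour 7 hc hf (by norm_num) (by norm_num)
        one_pos search_eleven_two_zero_zero_one
      exact absurd ht List.not_mem_nil
    · obtain ⟨t, ht, h⟩ := hH.exists_isTabulated hfour 7 hc hf (by norm_num) (by norm_num)
        one_pos search_twelve_zero_one_zero_one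
      exact absurd ht List.not_mem_nil
    · obtain ⟨t, ht, h⟩ := hH.exists_isTabulated hfour 8 hc hf (by norm_num) (by norm_num)
        one_pos search_twelve_one_zero_zero_zero_one
      exact absurd ht List.not_mem_nil
  · rcases hf with hf | hf
    · obtain ⟨t, ht, h⟩ := hH.exists_isTabulated hgen 4 hc hf (by norm_num) (by norm_num)
        one_pos search_six_seven
      obtain rfl := List.mem_singleton.1 ht
      exact hiso 2 h
    · obtain ⟨t, ht, h⟩ := hH.exists_isTabulated hgen 5 hc hf (by norm_num) (by norm_num)
        (by norm_num) search_seven_five_one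
      simp only [List.mem_cons, List.not_mem_nil, or_false] at ht
      rcases ht with rfl | rfl | rfl | rfl | rfl | rfl
      exacts [hiso 3 h, hopp 3 (Or.inl rfl) h, hiso 4 h, hiso 5 h, hopp 5 (Or.inr rfl) h, hiso 6 h]

end Classification

theorem mainTheorem4 {D : Type*} [Finite D] (H : Hypermap D) (hH : H.HasTameContact) :
    ∃ i : Fin 8, H.IsIsomorphic (contactHypermap i) ∨
      H.IsIsomorphic (contactHypermap i).opposite :=
  hH.exists_isIsomorphic
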